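/- An MV-algebra is an algebra $\langle A,\oplus,\neg,0\rangle$ such that $\oplus$ is associative and commutative with neutral element $0$, and $\neg\neg x = x$, $x\oplus\neg 0=\neg 0$ and $\neg(\neg x\oplus y)\oplus y=\neg(\neg y\oplus x)\oplus x$ hold. Put $1:=\neg 0$, $x\to y:=\neg x\oplus y$, $x*y:=\neg(\neg x\oplus\neg y)$ and $x\vee y:=\neg(\neg x\oplus y)\oplus y$. A monadic MV-algebra is an MV-algebra with two unary operations $\exists,\forall$ satisfying the identities $\forall x\to x=1$, $\forall(x\to\forall y)=\exists x\to\forall y$, $\forall(\forall x\to y)=\forall x\to\forall y$, $\forall(\exists x\vee y)=\exists x\vee\forall y$ and $\exists(x*x)=\exists x*\exists x$. Let $\mathbb{MMV}$ be the class of all monadic MV-algebras. For $m,n\ge 1$ let $\mathbf{L}_m$ be the $(m+1)$-element Łukasiewicz chain $\{0,\frac1m,\dots,1\}$, with $x\oplus y=\min(1,x+y)$ and $\neg x=1-x$, and let $\langle\mathbf{L}_m^n,\exists_\vee,\forall_\wedge\rangle$ be its $n$-th power with pointwise MV-operations, where $\exists_\vee f$ and $\forall_\wedge f$ are the constant $n$-tuples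 whose value is the supremum, respectively the infimum, of the $n$ coordinates of $f$. A quasivariety is a class of algebras of the language $\{\oplus,\neg,0,\exists,\forall\}$ that is axiomatized by a set of quasi-identities $s_1=t_1\ \&\ \dots\ \&\ s_k=t_k\Rightarrow s=t$ ($k\ge 0$ finite). **Theorem.** $\mathbb{MMV}$ is generated as a quasivariety by the algebras $\langle\mathbf{L}_m^n,\exists_\vee,\forall_\wedge\rangle$, $m,n\ge1$; that is, $\mathbb{MMV}$ is the least quasivariety that contains all of them. -/

import Mathlib

universe u

/-! ### Quasi-identities and quasivarieties -/

/-- A quasi-identity `s₁ = t₁ & … & sₖ = tₖ ⇒ s = t` between terms of an algebraic language `L`,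
with finitely many (possibly zero) premises and variables `x₀, x₁, …`. -/
structure QuasiIdentity (L : FirstOrder.Language.{0, 0}) where
  /-- The finite list of premises, each pair `(sᵢ, tᵢ)` standing for `sᵢ = tᵢ`. -/
  premises : List (L.Term ℕ × L.Term ℕ)
  /-- The conclusion `s = t`, as a pair `(s, t)`. -/
  conclusion : L.Term ℕ × L.Term ℕ

/-- The algebra `A` satisfies the quasi-identity `q` (universally quantified over its variables). -/
def QuasiIdentity.HoldsIn {L : FirstOrder.Language.{0, 0}} (q : QuasiIdentity L)
    (A : CategoryTheory.Bundled.{u} L.Structure) : Prop :=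
  ∀ v : ℕ → A,
    (∀ e ∈ q.premises, e.1.realize v = e.2.realize v) →
      q.conclusion.1.realize v = q.conclusion.2.realize v

/-- A class of algebras is a quasivariety if it is the class of all algebras satisfying
some set of quasi-identities. -/
def IsQuasivariety {L : FirstOrder.Language.{0, 0}}
    (Q : Set (CategoryTheory.Bundled.{u} L.Structure)) : Prop :=
  ∃ T : Set (QuasiIdentity L), ∀ A, A ∈ Q ↔ ∀ q ∈ T, q.HoldsIn A

/-- The class `V` is generated as a quasivariety by the class `K`:
`V` is the least quasivariety that contains `K`. -/
def IsGeneratedAsQuasivarietyBy {L : FirstOrder.Language.{0, 0}}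
    (V K : Set (CategoryTheory.Bundled.{u} L.Structure)) : Prop :=
  IsLeast {Q | IsQuasivariety Q ∧ K ⊆ Q} V

namespace MonadicMV

/-! ### The language of monadic MV-algebras -/

/-- The basic operation symbols `0, ¬, ⊕, ∃, ∀`. -/
inductive Func : ℕ → Type
  | zero : Func 0
  | neg : Func 1
  | oplus : Func 2
  | ex : Func 1
  | all : Func 1

/-- The algebraic language `{0, ¬, ⊕, ∃, ∀}` of monadic MV-algebras. -/
def language : FirstOrder.Language.{0, 0} where
  Functions := Func
  Relations := fun _ => Empty

/-- Interpretations of `0, ¬, ⊕, ∃, ∀` on a type make it an algebra of the language. -/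
abbrev mkStructure {A : Type u} (zero : A) (neg : A → A) (oplus : A → A → A) (ex all : A → A) :
    language.Structure A where
  funMap
    | Func.zero, _ => zero
    | Func.neg, x => neg (x 0)
    | Func.oplus, x => oplus (x 0) (x 1)
    | Func.ex, x => ex (x 0)
    | Func.all, x => all (x 0)
  RelMap r _ := r.elim

section Operations

variable {A : Type u} [language.Structure A]

/-- The constant `0`. -/
def zero : A := FirstOrder.Language.Structure.funMap (L := language) Func.zero ![]

/-- The negation `¬x`. -/
def neg (x : A) : A := FirstOrder.Language.Structure.funMap (L := language) Func.neg ![x]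

/-- The truncated sum `x ⊕ y`. -/
def oplus (x y : A) : A := FirstOrder.Language.Structure.funMap (L := language) Func.oplus ![x, y]

/-- The quantifier `∃x`. -/
def ex (x : A) : A := FirstOrder.Language.Structure.funMap (L := language) Func.ex ![x]

/-- The quantifier `∀x`. -/
def all (x : A) : A := FirstOrder.Language.Structure.funMap (L := language) Func.all ![x]

/-- The constant `1 := ¬0`. -/
def one : A := neg zero

/-- The implication `x → y := ¬x ⊕ y`. -/
def imp (x y : A) : A := oplus (neg x) y

/-- The product `x * y := ¬(¬x ⊕ ¬y)`. -/
def mul (x y : A) : A := neg (oplus (neg x) (neg y))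

/-- The join `x ∨ y := ¬(¬x ⊕ y) ⊕ y`. -/
def sup (x y : A) : A := oplus (neg (oplus (neg x) y)) y

end Operations

/-! ### Monadic MV-algebras -/

/-- `⟨A, ⊕, ¬, 0⟩` is an MV-algebra. -/
structure IsMV (A : Type u) [language.Structure A] : Prop where
  oplus_assoc : ∀ x y z : A, oplus x (oplus y z) = oplus (oplus x y) z
  oplus_comm : ∀ x y : A, oplus x y = oplus y x
  oplus_zero : ∀ x : A, oplus x zero = x
  neg_neg : ∀ x : A, neg (neg x) = x
  oplus_neg_zero : ∀ x : A, oplus x (neg zero) = neg zero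
  lukasiewicz : ∀ x y : A,
    oplus (neg (oplus (neg x) y)) y = oplus (neg (oplus (neg y) x)) x

/-- `⟨A, ∃, ∀⟩` is a monadic MV-algebra. -/
structure IsMonadicMV (A : Type u) [language.Structure A] : Prop extends IsMV A where
  m1 : ∀ x : A, imp (all x) x = one
  m2 : ∀ x y : A, all (imp x (all y)) = imp (ex x) (all y)
  m3 : ∀ x y : A, all (imp (all x) y) = imp (all x) (all y)
  m4 : ∀ x y : A, all (sup (ex x) y) = sup (ex x) (all y)
  m5 : ∀ x : A, ex (mul x x) = mul (ex x) (ex x)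

/-- The class `MMV` of all monadic MV-algebras (with universe in `Type u`). -/
def MMV : Set (CategoryTheory.Bundled.{u} language.Structure) :=
  {A | IsMonadicMV A}

/-! ### The finite algebras `⟨Lₘⁿ, ∃_∨, ∀_∧⟩` -/

/-- The universe of the `(m + 1)`-element MV-chain `Lₘ`; the element `k` represents `k / m`, and
the order is that of `Fin (m + 1)`. -/
abbrev Chain (m : ℕ) : Type := Fin (m + 1)

/-- `¬x = 1 - x` in `Lₘ`. -/
def Chain.neg {m : ℕ} (x : Chain m) : Chain m := ⟨m - (x : ℕ), by omega⟩

/-- `x ⊕ y = min (x + y, 1)` in `Lₘ`. -/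
def Chain.oplus {m : ℕ} (x y : Chain m) : Chain m := ⟨min ((x : ℕ) + (y : ℕ)) m, by omega⟩

/-- The algebra `⟨Lₘⁿ, ∃_∨, ∀_∧⟩`: the MV-operations are pointwise, `∃_∨ f` and `∀_∧ f` are the
constant functions with value the supremum, respectively the infimum, of the values of `f`. -/
noncomputable instance powerStructure (m n : ℕ) : language.Structure (Fin n → Chain m) :=
  mkStructure (fun _ => 0) (fun f i => Chain.neg (f i)) (fun f g i => Chain.oplus (f i) (g i))
    (fun f _ => Finset.univ.sup f) (fun f _ => Finset.univ.inf f)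

/-- The copy of `⟨Lₘⁿ, ∃_∨, ∀_∧⟩` whose universe lies in `Type u`. -/
noncomputable def power (m n : ℕ) : CategoryTheory.Bundled.{u} language.Structure where
  α := ULift.{u} (Fin n → Chain m)
  str := Equiv.ulift.symm.inducedStructure

end MonadicMV

/-!
A quasi-identity that fails in a monadic MV-algebra `A` fails already on a finite set `S ⊆ A`
containing elements `s ≰ t`, so it suffices to map `S` into some `Lₘⁿ` by a partial homomorphism
that separates `s` from `t`.

Choose a prime filter `P` of the subalgebra `∃A` of fixed elements that omits `∀(s → t)`. For each
`x ∈ A` there is a prime filter `Q` of `A` that contains `x → ∀x` and has trace `P` on `∃A`; the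
identity `∃(x * x) = ∃x * ∃x` is what keeps the powers of `x → ∀x` compatible with `P`. The
quotients `A/Q`, for `x` among finitely many elements, are MV-chains over the common chain
`∃A/P`. In this family of chains the value of `∀x` is the minimum of the values of `x`, because it
is a lower bound in each chain and is attained in the chain chosen for `x`; dually for `∃x`.

By Chang's construction the chains `A/Q` are unit intervals of totally ordered abelian groups over
the group of `∃A/P`. A theorem of the alternative for rational functionals on their amalgam
replaces these groups, as far as finitely many elements are concerned, by copies of `ℚ` that agree
on the common part, and a common denominator `m` then lands all values in `Lₘ`.
-/

/-! ### MV-algebras -/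

/-- An MV-algebra, with `⊕` written `+` and `¬` written `ᶜ`; the constant `1 := 0ᶜ`, the product
`x * y := (xᶜ + yᶜ)ᶜ`, the order `x ≤ y :↔ xᶜ + y = 1` and the join `x ⊔ y := (xᶜ + y)ᶜ + y` are
derived notions. -/
class MVAlgebra (A : Type*) extends AddCommMonoid A, Compl A where
  protected compl_compl : ∀ x : A, xᶜᶜ = x
  protected add_compl_zero : ∀ x : A, x + 0ᶜ = 0ᶜ
  protected lukasiewicz : ∀ x y : A, (xᶜ + y)ᶜ + y = (yᶜ + x)ᶜ + x

namespace MVAlgebra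

section Basic

variable {A : Type*} [MVAlgebra A] {x y z : A}

instance : One A := ⟨0ᶜ⟩

instance : Mul A := ⟨fun x y => (xᶜ + yᶜ)ᶜ⟩

theorem mul_def (x y : A) : x * y = (xᶜ + yᶜ)ᶜ := rfl

attribute [simp] MVAlgebra.compl_compl

@[simp] theorem compl_zero : (0 : A)ᶜ = 1 := rfl

@[simp] theorem compl_one : (1 : A)ᶜ = 0 := MVAlgebra.compl_compl 0

@[simp] theorem add_one (x : A) : x + 1 = 1 := MVAlgebra.add_compl_zero x

@[simp] theorem one_add (x : A) : 1 + x = 1 := by rw [add_comm, add_one]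

theorem compl_injective : Function.Injective (compl : A → A) :=
  Function.Involutive.injective MVAlgebra.compl_compl

theorem compl_mul (x y : A) : (x * y)ᶜ = xᶜ + yᶜ := MVAlgebra.compl_compl _

theorem compl_add (x y : A) : (x + y)ᶜ = xᶜ * yᶜ := by
  rw [mul_def, MVAlgebra.compl_compl, MVAlgebra.compl_compl]

instance : CommMonoid A where
  mul_assoc x y z := by simp only [mul_def, MVAlgebra.compl_compl, add_assoc]
  mul_comm x y := by rw [mul_def, add_comm, ← mul_def]
  one_mul x := by rw [mul_def, compl_one, zero_add, MVAlgebra.compl_compl]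
  mul_one x := by rw [mul_def, compl_one, add_zero, MVAlgebra.compl_compl]

@[simp] theorem compl_add_self (x : A) : xᶜ + x = 1 := by
  simpa only [add_one, compl_one, zero_add] using (MVAlgebra.lukasiewicz x 1).symm

theorem eq_add_of_compl_add_eq_one (h : xᶜ + y = 1) : y = x + (yᶜ + x)ᶜ := by
  simpa only [h, compl_one, zero_add, add_comm x] using MVAlgebra.lukasiewicz x y

instance : PartialOrder A where
  le x y := xᶜ + y = 1
  le_refl := compl_add_self
  le_trans x y z hxy hyz := by
    rw [eq_add_of_compl_add_eq_one hyz, eq_add_of_compl_add_eq_one hxy, ← add_assoc, ← add_assoc,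
      compl_add_self, one_add, one_add]
  le_antisymm x y hxy hyx := by
    simpa only [hxy, hyx, compl_one, zero_add] using (MVAlgebra.lukasiewicz x y).symm

theorem le_iff : x ≤ y ↔ xᶜ + y = 1 := Iff.rfl

theorem eq_add_of_le (h : x ≤ y) : y = x + (yᶜ + x)ᶜ := eq_add_of_compl_add_eq_one h

instance : CanonicallyOrderedAdd A where
  exists_add_of_le h := ⟨_, eq_add_of_le h⟩
  le_self_add x y := by rw [le_iff, ← add_assoc, compl_add_self, one_add]
  le_add_self x y := by rw [le_iff, add_left_comm, compl_add_self, add_one]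

theorem le_one (x : A) : x ≤ 1 := add_one _

theorem one_le_iff : 1 ≤ x ↔ x = 1 := (le_one x).ge_iff_eq

theorem compl_le_compl (h : x ≤ y) : yᶜ ≤ xᶜ := by
  rwa [le_iff, MVAlgebra.compl_compl, add_comm]

theorem mul_le_iff : x * y ≤ z ↔ x ≤ yᶜ + z := by
  rw [le_iff, le_iff, compl_mul, add_assoc]

instance : IsOrderedAddMonoid A where
  add_le_add_left x y h z := by
    rw [eq_add_of_le h, add_right_comm]
    exact le_self_add

instance : IsOrderedMonoid A where
  mul_le_mul_left _ _ h _ := compl_le_compl (add_le_add_left (compl_le_compl h) _)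

theorem mul_le_left (x y : A) : x * y ≤ x := mul_le_of_le_one_right' (le_one y)

theorem mul_le_right (x y : A) : x * y ≤ y := mul_le_of_le_one_left' (le_one x)

theorem mul_imp_le (x y : A) : x * (xᶜ + y) ≤ y := by
  rw [mul_comm, mul_le_iff]

instance : SemilatticeSup A where
  sup x y := (xᶜ + y)ᶜ + y
  le_sup_left x y := by
    rw [MVAlgebra.lukasiewicz]
    exact le_add_self
  le_sup_right x y := le_add_self
  sup_le x y z hx hy := by
    rw [eq_add_of_le hy, add_comm]
    exact add_le_add_right (compl_le_compl (add_le_add_left (compl_le_compl hx) _)) _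

theorem sup_def (x y : A) : x ⊔ y = (xᶜ + y)ᶜ + y := rfl

theorem sup_mul_le {t : A} (hx : x * z ≤ t) (hy : y * z ≤ t) : (x ⊔ y) * z ≤ t :=
  mul_le_iff.2 (sup_le (mul_le_iff.1 hx) (mul_le_iff.1 hy))

theorem add_mul_compl_of_le (h : x ≤ yᶜ) : (x + y) * yᶜ = x := by
  refine compl_injective ?_
  rw [compl_mul, MVAlgebra.compl_compl, add_comm]
  simpa only [MVAlgebra.compl_compl] using (eq_add_of_le (compl_le_compl h)).symm

theorem mul_add_compl_of_le (h : yᶜ ≤ x) : x * y + yᶜ = x := by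
  rw [mul_def, add_comm]
  exact (eq_add_of_le h).symm

theorem le_compl_iff : x ≤ yᶜ ↔ x * y = 0 := by
  rw [← add_zero yᶜ, ← mul_le_iff, nonpos_iff_eq_zero]

theorem compl_le_iff : xᶜ ≤ y ↔ x + y = 1 := by
  rw [le_iff, MVAlgebra.compl_compl]

theorem mul_imp_comm (x y : A) : x * (xᶜ + y) = y * (yᶜ + x) := by
  refine compl_injective ?_
  rw [compl_mul, compl_mul, add_comm, add_comm yᶜ, add_comm xᶜ, add_comm yᶜ]
  simpa only [MVAlgebra.compl_compl] using MVAlgebra.lukasiewicz yᶜ xᶜ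

theorem add_add_mul (x y : A) : x + y + x * y = x + y := by
  have split_sum : xᶜ * (x + y) + x = x + y := by
    simpa only [mul_comm, MVAlgebra.compl_compl] using
      mul_add_compl_of_le (x := x + y) (y := xᶜ) (by simp)
  have split_right : y * (yᶜ + xᶜ) + x * y = y := by
    simpa only [compl_add, MVAlgebra.compl_compl, mul_comm x] using
      mul_add_compl_of_le (x := y) (y := yᶜ + xᶜ) (by rw [← mul_def]; exact mul_le_left y x)
  calc x + y + x * y = x + (xᶜ * (x + y) + x * y) := by
        rw [← add_assoc, add_comm x (_ * _), split_sum]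
    _ = x + (y * (yᶜ + xᶜ) + x * y) := by rw [← mul_imp_comm, MVAlgebra.compl_compl]
    _ = x + y := by rw [split_right]

theorem imp_sup_imp (x y : A) : (xᶜ + y) ⊔ (yᶜ + x) = 1 := by
  have absorb : (xᶜ + y)ᶜ + (yᶜ + x) = yᶜ + x := by
    simpa only [compl_add, MVAlgebra.compl_compl, add_comm] using add_add_mul yᶜ x
  rw [sup_def, absorb, compl_add_self]

end Basic

variable {A B : Type*} [MVAlgebra A] [MVAlgebra B]

instance [Nontrivial A] : NeZero (1 : A) where
  out h := not_subsingleton A ⟨fun x y => by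
    rw [← zero_add x, ← zero_add y, ← h, one_add, one_add]⟩

/-- A homomorphism of MV-algebras. -/
structure Hom (A B : Type*) [MVAlgebra A] [MVAlgebra B] extends A →+ B where
  map_compl' : ∀ x, toFun xᶜ = (toFun x)ᶜ

namespace Hom

instance : FunLike (Hom A B) A B where
  coe f := f.toFun
  coe_injective f g h := by
    cases f
    cases g
    congr
    exact DFunLike.coe_injective h

instance : AddMonoidHomClass (Hom A B) A B where
  map_add f := f.map_add'
  map_zero f := f.map_zero'

variable (f : Hom A B)

theorem map_compl (x : A) : f xᶜ = (f x)ᶜ := f.map_compl' x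

theorem map_one : f 1 = 1 := by
  rw [← compl_zero, map_compl, map_zero, compl_zero]

theorem map_mul (x y : A) : f (x * y) = f x * f y := by
  simp only [mul_def, map_compl, map_add]

theorem map_sup (x y : A) : f (x ⊔ y) = f x ⊔ f y := by
  simp only [sup_def, map_compl, map_add]

end Hom

end MVAlgebra

/-! ### Filters and quotients -/

/-- An implicative filter of an MV-algebra: a set that contains `1` and is closed under modus
ponens. These are exactly the classes of `1` under congruences. -/
structure ImplicativeFilter (A : Type*) [MVAlgebra A] where
  carrier : Set A
  one_mem' : 1 ∈ carrier
  mp' : ∀ {x y : A}, x ∈ carrier → xᶜ + y ∈ carrier → y ∈ carrier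

namespace ImplicativeFilter

open MVAlgebra

variable {A B : Type*} [MVAlgebra A] [MVAlgebra B] {F : ImplicativeFilter A} {x y : A}

instance : SetLike (ImplicativeFilter A) A where
  coe := carrier
  coe_injective F G h := by
    cases F
    congr

instance : PartialOrder (ImplicativeFilter A) := .ofSetLike (ImplicativeFilter A) A

theorem one_mem (F : ImplicativeFilter A) : 1 ∈ F := F.one_mem'

theorem mp (hx : x ∈ F) (hxy : xᶜ + y ∈ F) : y ∈ F := F.mp' hx hxy

theorem mem_of_le (hx : x ∈ F) (h : x ≤ y) : y ∈ F :=
  mp hx ((le_iff.1 h).symm ▸ F.one_mem)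

theorem mul_mem (hx : x ∈ F) (hy : y ∈ F) : x * y ∈ F :=
  mp hy (mem_of_le hx (mul_le_iff.1 le_rfl))

instance : Bot (ImplicativeFilter A) where
  bot :=
    { carrier := {1}
      one_mem' := rfl
      mp' := by
        rintro x y rfl hy
        rwa [compl_one, zero_add] at hy }

theorem mem_bot : x ∈ (⊥ : ImplicativeFilter A) ↔ x = 1 := Iff.rfl

/-- The filter of all `x` with `x ⊔ z ∈ F`. -/
def residual (F : ImplicativeFilter A) (z : A) : ImplicativeFilter A where
  carrier := {x | x ⊔ z ∈ F}
  one_mem' := mem_of_le F.one_mem le_sup_left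
  mp' {x y} hx hxy := by
    refine mem_of_le (mul_mem hx hxy) (sup_mul_le ?_ ((mul_le_left z _).trans le_sup_right))
    rw [mul_comm]
    refine sup_mul_le ?_ ((mul_le_left z _).trans le_sup_right)
    rw [mul_comm]
    exact (mul_imp_le x y).trans le_sup_left

theorem le_residual (F : ImplicativeFilter A) (z : A) : F ≤ F.residual z :=
  fun x hx => show x ⊔ z ∈ F from mem_of_le hx le_sup_left

/-- A proper filter is prime if it contains one of the members of each join that it contains. -/
structure IsPrime (F : ImplicativeFilter A) : Prop where
  zero_notMem : 0 ∉ F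
  mem_or_mem : ∀ {x y : A}, x ⊔ y ∈ F → x ∈ F ∨ y ∈ F

theorem exists_upperBound_of_isChain {c : Set (ImplicativeFilter A)} (hc : IsChain (· ≤ ·) c)
    (hne : c.Nonempty) : ∃ G : ImplicativeFilter A, (∀ x, x ∈ G ↔ ∃ F ∈ c, x ∈ F) :=
  let ⟨F, hF⟩ := hne
  ⟨{ carrier := {x | ∃ F ∈ c, x ∈ F}
     one_mem' := ⟨F, hF, F.one_mem⟩
     mp' := by
      rintro x y ⟨G, hG, hx⟩ ⟨H, hH, hxy⟩
      rcases hc.total hG hH with hGH | hHG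
      · exact ⟨H, hH, mp (hGH hx) hxy⟩
      · exact ⟨G, hG, mp hx (hHG hxy)⟩ }, fun _ => Iff.rfl⟩

theorem exists_maximal_disjoint {I : Set A} (hFI : Disjoint (F : Set A) I) :
    ∃ Q, F ≤ Q ∧ Maximal (fun G : ImplicativeFilter A => Disjoint (G : Set A) I) Q := by
  refine zorn_le_nonempty₀ {G : ImplicativeFilter A | Disjoint (G : Set A) I} ?_ F hFI
  intro c hcI hc G hG
  obtain ⟨U, hU⟩ := exists_upperBound_of_isChain hc ⟨G, hG⟩
  refine ⟨U, Set.disjoint_left.2 fun x hx => ?_, fun H hH x hx => (hU x).2 ⟨H, hH, hx⟩⟩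
  obtain ⟨H, hH, hxH⟩ := (hU x).1 hx
  exact Set.disjoint_left.1 (hcI hH) hxH

theorem exists_isPrime_disjoint {I : Set A} (hne : I.Nonempty) (hI : SupClosed I)
    (hFI : Disjoint (F : Set A) I) :
    ∃ Q, F ≤ Q ∧ Disjoint (Q : Set A) I ∧ Q.IsPrime := by
  obtain ⟨Q, hFQ, hQ⟩ := exists_maximal_disjoint hFI
  refine ⟨Q, hFQ, hQ.prop, fun h0 => ?_, fun {x y} hxy => ?_⟩
  · obtain ⟨a, ha⟩ := hne
    exact Set.disjoint_left.1 hQ.prop (mem_of_le h0 zero_le) ha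
  have meets_of_notMem : ∀ {z w : A}, z ⊔ w ∈ Q → z ∉ Q → ∃ c ∈ I, c ⊔ w ∈ Q := by
    intro z w hzw hz
    by_contra! h
    have residual_disjoint : Disjoint (Q.residual w : Set A) I :=
      Set.disjoint_left.2 fun c hc hcI => h c hcI hc
    exact hz (hQ.le_of_ge residual_disjoint (Q.le_residual w) hzw)
  by_contra! h
  obtain ⟨c, hc, hcy⟩ := meets_of_notMem hxy h.1
  obtain ⟨d, hd, hdc⟩ := meets_of_notMem (sup_comm c y ▸ hcy) h.2
  exact Set.disjoint_left.1 hQ.prop hdc (hI hd hc)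

theorem exists_isPrime_notMem {a : A} (ha : a ≠ 1) :
    ∃ Q : ImplicativeFilter A, Q.IsPrime ∧ a ∉ Q := by
  obtain ⟨Q, -, hQa, hQ⟩ := exists_isPrime_disjoint (F := ⊥) (Set.singleton_nonempty a)
    supClosed_singleton (Set.disjoint_singleton_right.2 fun h => ha (mem_bot.1 h))
  exact ⟨Q, hQ, Set.disjoint_singleton_right.1 hQa⟩

/-- The inverse image of a filter under a homomorphism. -/
def comap (g : Hom A B) (F : ImplicativeFilter B) : ImplicativeFilter A where
  carrier := {x | g x ∈ F}
  one_mem' := by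
    change g 1 ∈ F
    rw [g.map_one]
    exact F.one_mem
  mp' hx hxy := mp hx (by rwa [← g.map_compl, ← map_add])

theorem mem_comap {g : Hom A B} {F : ImplicativeFilter B} : x ∈ F.comap g ↔ g x ∈ F := Iff.rfl

theorem imp_trans_mem {z : A} (hxy : xᶜ + y ∈ F) (hyz : yᶜ + z ∈ F) : xᶜ + z ∈ F := by
  refine mem_of_le (mul_mem hxy hyz) ?_
  rw [← mul_le_iff, mul_right_comm, mul_comm _ x]
  exact (mul_le_mul_left (mul_imp_le x y) _).trans (mul_imp_le y z)

theorem add_imp_add_mem {x' y' : A} (hx : xᶜ + x' ∈ F) (hy : yᶜ + y' ∈ F) :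
    (x + y)ᶜ + (x' + y') ∈ F := by
  refine mem_of_le (mul_mem hx hy) ?_
  rw [← mul_le_iff, mul_comm, mul_le_iff, compl_mul, add_add_add_comm]
  exact add_le_add (mul_le_iff.1 (mul_imp_le x x')) (mul_le_iff.1 (mul_imp_le y y'))

/-- The congruence associated with a filter. -/
def addCon (F : ImplicativeFilter A) : AddCon A where
  r x y := xᶜ + y ∈ F ∧ yᶜ + x ∈ F
  iseqv :=
    { refl x := by simp only [compl_add_self, F.one_mem, and_self]
      symm := And.symm
      trans hxy hyz := ⟨imp_trans_mem hxy.1 hyz.1, imp_trans_mem hyz.2 hxy.2⟩ }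
  add' hx hy := ⟨add_imp_add_mem hx.1 hy.1, add_imp_add_mem hx.2 hy.2⟩

theorem addCon_iff : F.addCon x y ↔ xᶜ + y ∈ F ∧ yᶜ + x ∈ F := Iff.rfl

theorem addCon_compl (h : F.addCon x y) : F.addCon xᶜ yᶜ := by
  rw [addCon_iff, MVAlgebra.compl_compl, MVAlgebra.compl_compl, add_comm x, add_comm y]
  exact (addCon_iff.1 h).symm

/-- The quotient of an MV-algebra by a filter. -/
abbrev Quotient (F : ImplicativeFilter A) := F.addCon.Quotient

instance : MVAlgebra F.Quotient where
  compl := Quotient.map' compl fun _ _ => addCon_compl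
  compl_compl := by
    rintro ⟨x⟩
    exact congrArg F.addCon.mk' (MVAlgebra.compl_compl x)
  add_compl_zero := by
    rintro ⟨x⟩
    exact congrArg F.addCon.mk' (MVAlgebra.add_compl_zero x)
  lukasiewicz := by
    rintro ⟨x⟩ ⟨y⟩
    exact congrArg F.addCon.mk' (MVAlgebra.lukasiewicz x y)

/-- The canonical homomorphism onto the quotient by a filter. -/
def proj (F : ImplicativeFilter A) : Hom A F.Quotient where
  __ := F.addCon.mk'
  map_compl' _ := rfl

theorem proj_le_proj : F.proj x ≤ F.proj y ↔ xᶜ + y ∈ F := by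
  rw [le_iff, ← Hom.map_compl, ← map_add, ← F.proj.map_one]
  refine F.addCon.eq.trans ?_
  rw [addCon_iff, add_one, compl_one, zero_add]
  exact and_iff_right F.one_mem

theorem proj_eq_one : F.proj x = 1 ↔ x ∈ F := by
  rw [← one_le_iff, ← F.proj.map_one, proj_le_proj, compl_one, zero_add]

theorem IsPrime.nontrivial (hF : F.IsPrime) : Nontrivial F.Quotient :=
  ⟨F.proj 0, 1, mt proj_eq_one.1 hF.zero_notMem⟩

theorem IsPrime.total (hF : F.IsPrime) :
    Std.Total ((· ≤ ·) : F.Quotient → F.Quotient → Prop) where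
  total := by
    rintro ⟨x⟩ ⟨y⟩
    refine (hF.mem_or_mem (x := xᶜ + y) (y := yᶜ + x) ?_).imp proj_le_proj.2 proj_le_proj.2
    rw [imp_sup_imp]
    exact F.one_mem

/-- The homomorphism of quotients induced by a homomorphism `g`, for a filter `P` that is the
inverse image under `g` of a filter `F`. -/
def quotientMap {P : ImplicativeFilter A} {F : ImplicativeFilter B} (g : Hom A B)
    (h : F.comap g = P) : Hom P.Quotient F.Quotient where
  toFun := Quotient.map' g fun x y hxy => by
    subst h
    change F.addCon (g x) (g y)
    simpa only [addCon_iff, mem_comap, map_add, g.map_compl] using addCon_iff.1 hxy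
  map_zero' := congrArg F.proj (map_zero g)
  map_add' := by
    rintro ⟨x⟩ ⟨y⟩
    exact congrArg F.proj (map_add g x y)
  map_compl' := by
    rintro ⟨x⟩
    exact congrArg F.proj (g.map_compl x)

theorem quotientMap_injective {P : ImplicativeFilter A} {F : ImplicativeFilter B} {g : Hom A B}
    (h : F.comap g = P) : Function.Injective (quotientMap g h) := by
  subst h
  rintro ⟨x⟩ ⟨y⟩ hxy
  refine (addCon _).eq.2 ?_
  simpa only [addCon_iff, mem_comap, map_add, g.map_compl] using F.addCon.eq.1 hxy

end ImplicativeFilter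

/-! ### Chang's ordered group of an MV-chain -/

namespace MVAlgebra

variable {C : Type*} [MVAlgebra C] {a b c : C}

theorem mul_ne_one (h : a ≠ 1) : a * b ≠ 1 := fun hab => h (one_le_iff.1 (hab ▸ mul_le_left a b))

theorem compl_ne_one (h : a ≠ 0) : aᶜ ≠ 1 :=
  fun h1 => h (compl_injective (h1.trans compl_zero.symm))

theorem mul_add_eq_add_mul (hab : a + b = 1) (hbc : b + c = 1) : a * b + c = a + b * c := by
  have ha : a * b + bᶜ = a := mul_add_compl_of_le (compl_le_iff.2 (by rwa [add_comm]))
  have hc : c * b + bᶜ = c := mul_add_compl_of_le (compl_le_iff.2 hbc)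
  calc a * b + c = a * b + (c * b + bᶜ) := by rw [hc]
    _ = a * b + bᶜ + b * c := by rw [mul_comm c b, add_comm (b * c), add_assoc]
    _ = a + b * c := by rw [ha]

variable [Std.Total ((· ≤ ·) : C → C → Prop)]

theorem mul_eq_zero_of_add_ne_one (h : a + b ≠ 1) : a * b = 0 :=
  le_compl_iff.1 ((total_of (· ≤ ·) a bᶜ).resolve_right fun hba =>
    h ((add_comm a b).trans (compl_le_iff.1 hba)))

theorem add_mul_eq_mul_add (hab : a + b ≠ 1) (hbc : b + c ≠ 1) :
    (a + b) * c = a * (b + c) := by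
  have ha : (a + b) * bᶜ = a := add_mul_compl_of_le (le_compl_iff.2 (mul_eq_zero_of_add_ne_one hab))
  have hc : (c + b) * bᶜ = c := add_mul_compl_of_le
    (le_compl_iff.2 (mul_eq_zero_of_add_ne_one (by rwa [add_comm])))
  calc (a + b) * c = (a + b) * ((c + b) * bᶜ) := by rw [hc]
    _ = (a + b) * bᶜ * (b + c) := by rw [add_comm c b, mul_comm (b + c), mul_assoc]
    _ = a * (b + c) := by rw [ha]

theorem add_mul_eq_add_mul (hab : a + b ≠ 1) (hbc : b + c = 1) : (a + b) * c = a + b * c := by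
  have hb : b * c + cᶜ = b := mul_add_compl_of_le (compl_le_iff.2 (by rwa [add_comm]))
  have hsum : a + b * c + cᶜ ≠ 1 := by rwa [add_assoc, hb]
  simpa only [MVAlgebra.compl_compl, add_assoc, hb] using
    add_mul_compl_of_le (le_compl_iff.2 (mul_eq_zero_of_add_ne_one hsum))

theorem add_mul_ne_one (hab : a + b ≠ 1) (hbc : b + c = 1) : a + b * c ≠ 1 :=
  add_mul_eq_add_mul hab hbc ▸ mul_ne_one hab

end MVAlgebra

/-- Chang's group of an MV-chain `C`: the pair of `int` and `frac ≠ 1` stands for `int` copies of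
the unit plus `frac`, so that `C` is the interval between `0` and the unit. -/
@[ext] structure ChangGroup (C : Type*) [MVAlgebra C] where
  int : ℤ
  frac : C
  frac_ne_one : frac ≠ 1

namespace ChangGroup

open MVAlgebra

variable {C : Type*} [MVAlgebra C]

open Classical in
/-- The carry is `1` if the sum of the fractional parts reaches the unit. -/
noncomputable instance : Add (ChangGroup C) where
  add x y :=
    if h : x.frac + y.frac = 1 then ⟨x.int + y.int + 1, x.frac * y.frac, mul_ne_one x.frac_ne_one⟩
    else ⟨x.int + y.int, x.frac + y.frac, h⟩

variable {x y z : ChangGroup C}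

theorem add_of_eq_one (h : x.frac + y.frac = 1) :
    x + y = ⟨x.int + y.int + 1, x.frac * y.frac, mul_ne_one x.frac_ne_one⟩ := dif_pos h

theorem add_of_ne_one (h : x.frac + y.frac ≠ 1) :
    x + y = ⟨x.int + y.int, x.frac + y.frac, h⟩ := dif_neg h

theorem int_add_int_le (x y : ChangGroup C) : x.int + y.int ≤ (x + y).int := by
  by_cases h : x.frac + y.frac = 1
  · rw [add_of_eq_one h]
    exact (lt_add_one _).le
  · rw [add_of_ne_one h]

protected theorem add_comm (x y : ChangGroup C) : x + y = y + x := by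
  by_cases h : x.frac + y.frac = 1
  · rw [add_of_eq_one h, add_of_eq_one (by rwa [add_comm])]
    simp only [add_comm, mul_comm]
  · rw [add_of_ne_one h, add_of_ne_one (by rwa [add_comm])]
    simp only [add_comm]

theorem add_assoc_of_eq_one_of_eq_one (hxy : x.frac + y.frac = 1) (hyz : y.frac + z.frac = 1) :
    x + y + z = x + (y + z) := by
  have hfrac := mul_add_eq_add_mul hxy hyz
  rw [add_of_eq_one hxy, add_of_eq_one hyz]
  by_cases h : x.frac + y.frac * z.frac = 1
  · rw [add_of_eq_one (by exact hfrac.trans h), add_of_eq_one (by exact h)]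
    ext
    · simp only
      ring
    · exact mul_assoc _ _ _
  · rw [add_of_ne_one (by simpa only [hfrac] using h), add_of_ne_one (by exact h)]
    ext
    · simp only
      ring
    · exact hfrac

section Total

variable [Std.Total ((· ≤ ·) : C → C → Prop)]

theorem add_assoc_of_ne_one_of_eq_one (hxy : x.frac + y.frac ≠ 1) (hyz : y.frac + z.frac = 1) :
    x + y + z = x + (y + z) := by
  have hsum : x.frac + y.frac + z.frac = 1 := by rw [add_assoc, hyz, add_one]
  rw [add_of_ne_one hxy, add_of_eq_one hyz, add_of_eq_one (by exact hsum),
    add_of_ne_one (by exact add_mul_ne_one hxy hyz)]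
  ext
  · simp only [add_assoc]
  · exact add_mul_eq_add_mul hxy hyz

theorem add_assoc_of_ne_one_of_ne_one (hxy : x.frac + y.frac ≠ 1) (hyz : y.frac + z.frac ≠ 1) :
    x + y + z = x + (y + z) := by
  rw [add_of_ne_one hxy, add_of_ne_one hyz]
  by_cases h : x.frac + (y.frac + z.frac) = 1
  · rw [add_of_eq_one (by simpa only [add_assoc] using h), add_of_eq_one (by exact h)]
    ext
    · simp only [add_assoc]
    · exact add_mul_eq_mul_add hxy hyz
  · rw [add_of_ne_one (by simpa only [add_assoc] using h), add_of_ne_one (by exact h)]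
    ext
    · exact add_assoc _ _ _
    · exact add_assoc _ _ _

protected theorem add_assoc (x y z : ChangGroup C) : x + y + z = x + (y + z) := by
  by_cases hxy : x.frac + y.frac = 1 <;> by_cases hyz : y.frac + z.frac = 1
  · exact add_assoc_of_eq_one_of_eq_one hxy hyz
  · have hzyx := add_assoc_of_ne_one_of_eq_one (x := z) (y := y) (z := x)
      (by rwa [add_comm]) (by rwa [add_comm])
    rw [ChangGroup.add_comm x, ChangGroup.add_comm _ z, ChangGroup.add_comm x,
      ChangGroup.add_comm y z, ← hzyx]
  · exact add_assoc_of_ne_one_of_eq_one hxy hyz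
  · exact add_assoc_of_ne_one_of_ne_one hxy hyz

end Total

variable [Nontrivial C]

instance : Zero (ChangGroup C) := ⟨⟨0, 0, zero_ne_one⟩⟩

protected theorem add_zero (x : ChangGroup C) : x + 0 = x := by
  have h : x.frac + (0 : ChangGroup C).frac = x.frac := add_zero x.frac
  rw [add_of_ne_one (h.trans_ne x.frac_ne_one)]
  ext
  · exact add_zero _
  · exact h

open Classical in
noncomputable instance : Neg (ChangGroup C) where
  neg x := if h : x.frac = 0 then ⟨-x.int, 0, zero_ne_one⟩
    else ⟨-x.int - 1, x.fracᶜ, compl_ne_one h⟩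

theorem neg_of_eq_zero (h : x.frac = 0) : -x = ⟨-x.int, 0, zero_ne_one⟩ := dif_pos h

theorem neg_of_ne_zero (h : x.frac ≠ 0) : -x = ⟨-x.int - 1, x.fracᶜ, compl_ne_one h⟩ := dif_neg h

theorem int_neg_of_eq_zero (h : x.frac = 0) : (-x).int = -x.int := by rw [neg_of_eq_zero h]

theorem int_neg_of_ne_zero (h : x.frac ≠ 0) : (-x).int = -x.int - 1 := by rw [neg_of_ne_zero h]

protected theorem neg_add_cancel (x : ChangGroup C) : -x + x = 0 := by
  by_cases h : x.frac = 0
  · rw [neg_of_eq_zero h, add_of_ne_one (by simpa only [zero_add] using x.frac_ne_one)]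
    ext
    · exact neg_add_cancel _
    · exact (zero_add _).trans h
  · rw [neg_of_ne_zero h, add_of_eq_one (by exact compl_add_self _)]
    ext
    · change -x.int - 1 + x.int + 1 = 0
      ring
    · exact le_compl_iff.1 le_rfl

open Classical in
/-- The inclusion of an MV-chain in its Chang group. -/
noncomputable def incl (a : C) : ChangGroup C :=
  if h : a = 1 then ⟨1, 0, zero_ne_one⟩ else ⟨0, a, h⟩

variable {a b : C}

theorem incl_one : incl (1 : C) = ⟨1, 0, zero_ne_one⟩ := dif_pos rfl

theorem incl_of_ne_one (h : a ≠ 1) : incl a = ⟨0, a, h⟩ := dif_neg h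

theorem incl_zero : incl (0 : C) = 0 := incl_of_ne_one zero_ne_one

theorem incl_injective : Function.Injective (incl : C → ChangGroup C) := by
  intro a b hab
  by_cases ha : a = 1 <;> by_cases hb : b = 1
  · rw [ha, hb]
  · rw [ha, incl_one, incl_of_ne_one hb] at hab
    exact absurd (congrArg int hab) one_ne_zero
  · rw [hb, incl_one, incl_of_ne_one ha] at hab
    exact absurd (congrArg int hab) zero_ne_one
  · rw [incl_of_ne_one ha, incl_of_ne_one hb] at hab
    exact congrArg frac hab

theorem incl_add_incl_of_ne_one (h : a + b ≠ 1) : incl a + incl b = incl (a + b) := by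
  have ha : a ≠ 1 := by
    rintro rfl
    exact h (one_add b)
  have hb : b ≠ 1 := by
    rintro rfl
    exact h (add_one a)
  rw [incl_of_ne_one h, incl_of_ne_one ha, incl_of_ne_one hb, add_of_ne_one (by exact h)]
  simp only [add_zero]

variable [Std.Total ((· ≤ ·) : C → C → Prop)]

noncomputable instance : AddCommGroup (ChangGroup C) where
  add_assoc := ChangGroup.add_assoc
  zero_add x := by rw [ChangGroup.add_comm, ChangGroup.add_zero]
  add_zero := ChangGroup.add_zero
  nsmul := nsmulRec
  zsmul := zsmulRec
  neg_add_cancel := ChangGroup.neg_add_cancel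
  add_comm := ChangGroup.add_comm

variable (C) in
/-- The positive cone of Chang's group. -/
noncomputable def cone : AddGroupCone (ChangGroup C) where
  carrier := {x | 0 ≤ x.int}
  add_mem' {x y} hx hy := (add_nonneg hx hy).trans (int_add_int_le x y)
  zero_mem' := le_refl (0 : ℤ)
  eq_zero_of_mem_of_neg_mem' {x} (hx : 0 ≤ x.int) (hx' : 0 ≤ (-x).int) := by
    by_cases h : x.frac = 0
    · rw [int_neg_of_eq_zero h] at hx'
      exact ChangGroup.ext (le_antisymm (neg_nonneg.1 hx') hx) h
    · rw [int_neg_of_ne_zero h] at hx'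
      lia

theorem mem_cone : x ∈ cone C ↔ 0 ≤ x.int := Iff.rfl

instance : HasMemOrNegMem (cone C) where
  mem_or_neg_mem x := by
    rw [mem_cone, mem_cone]
    by_cases h : x.frac = 0
    · rw [int_neg_of_eq_zero h]
      lia
    · rw [int_neg_of_ne_zero h]
      lia

open Classical in
noncomputable instance : LinearOrder (ChangGroup C) := LinearOrder.mkOfAddGroupCone (cone C)

instance : IsOrderedAddMonoid (ChangGroup C) := IsOrderedAddMonoid.mkOfCone (cone C)

theorem nonneg_iff : 0 ≤ x ↔ 0 ≤ x.int := by
  rw [← mem_cone]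
  change x - 0 ∈ cone C ↔ _
  rw [sub_zero]

theorem incl_nonneg (a : C) : 0 ≤ incl a := by
  rw [nonneg_iff]
  by_cases h : a = 1
  · rw [h, incl_one]
    exact zero_le_one
  · rw [incl_of_ne_one h]

theorem incl_add_incl_of_eq_one (h : a + b = 1) : incl a + incl b = incl 1 + incl (a * b) := by
  by_cases ha : a = 1
  · rw [ha, one_mul]
  by_cases hb : b = 1
  · rw [hb, mul_one, add_comm]
  rw [incl_of_ne_one ha, incl_of_ne_one hb, incl_one, incl_of_ne_one (mul_ne_one ha),
    add_of_eq_one (by exact h), add_of_ne_one (by simpa only [zero_add] using mul_ne_one ha)]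
  simp only [zero_add, add_zero]

theorem incl_compl (a : C) : incl aᶜ = incl 1 - incl a := by
  rw [eq_sub_iff_add_eq, incl_add_incl_of_eq_one (compl_add_self a), mul_comm,
    le_compl_iff.1 (MVAlgebra.compl_compl a).ge, incl_zero, add_zero]

theorem incl_le_incl_one (a : C) : incl a ≤ incl 1 :=
  sub_nonneg.1 (incl_compl a ▸ incl_nonneg aᶜ)

theorem incl_add (a b : C) : incl (a + b) = min (incl a + incl b) (incl 1) := by
  by_cases h : a + b = 1
  · rw [h, incl_add_incl_of_eq_one h, min_eq_right (le_add_of_nonneg_right (incl_nonneg _))]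
  · rw [incl_add_incl_of_ne_one h, min_eq_left (incl_le_incl_one _)]

theorem incl_strictMono : StrictMono (incl : C → ChangGroup C) := by
  refine Monotone.strictMono_of_injective (fun a b hab => ?_) incl_injective
  obtain ⟨c, rfl⟩ := exists_add_of_le hab
  rw [incl_add]
  exact le_min (le_add_of_nonneg_right (incl_nonneg c)) (incl_le_incl_one a)

section Map

variable {D : Type*} [MVAlgebra D] [Nontrivial D] [Std.Total ((· ≤ ·) : D → D → Prop)]

/-- The homomorphism of Chang groups induced by an injective homomorphism of MV-chains. -/
noncomputable def map (f : Hom C D) (hf : Function.Injective f) : ChangGroup C →+ ChangGroup D where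
  toFun x := ⟨x.int, f x.frac, fun h => x.frac_ne_one (hf (h.trans f.map_one.symm))⟩
  map_zero' := ChangGroup.ext rfl (map_zero f)
  map_add' x y := by
    by_cases h : x.frac + y.frac = 1
    · rw [add_of_eq_one h, add_of_eq_one (by rw [← map_add, h, f.map_one])]
      simp only [f.map_mul]
    · rw [add_of_ne_one h, add_of_ne_one (by rwa [← map_add, ← f.map_one, hf.ne_iff])]
      simp only [map_add]

variable {f : Hom C D} (hf : Function.Injective f)

theorem int_map (x : ChangGroup C) : (map f hf x).int = x.int := rfl

theorem frac_map (x : ChangGroup C) : (map f hf x).frac = f x.frac := rfl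

theorem map_strictMono : StrictMono (map f hf) := by
  refine Monotone.strictMono_of_injective ?_ fun x y h => ?_
  · rw [monotone_iff_map_nonneg]
    intro x hx
    rwa [nonneg_iff, int_map, ← nonneg_iff]
  · exact ChangGroup.ext (by rw [← int_map hf, h, int_map])
      (hf (by rw [← frac_map hf, h, frac_map]))

theorem map_incl (a : C) : map f hf (incl a) = incl (f a) := by
  by_cases h : a = 1
  · rw [h, f.map_one, incl_one, incl_one]
    exact ChangGroup.ext rfl (map_zero f)
  · rw [incl_of_ne_one h, incl_of_ne_one (f.map_one ▸ hf.ne h)]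
    rfl

end Map

end ChangGroup

/-! ### Rational functionals on ordered groups -/

section OrderedGroup

theorem exists_nat_mul_eq_nat_mul {q r : ℚ} (hq : 0 < q) (hr : 0 < r) :
    ∃ u v : ℕ, 0 < u ∧ 0 < v ∧ (u : ℚ) * q = v * r := by
  lift q to ℚ≥0 using hq.le
  lift r to ℚ≥0 using hr.le
  norm_cast at hq hr ⊢
  refine ⟨r.num * q.den, q.num * r.den, by positivity, by positivity, ?_⟩
  rw [Nat.cast_mul, Nat.cast_mul, mul_assoc, mul_assoc, NNRat.den_mul_eq_num,
    NNRat.den_mul_eq_num, mul_comm]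

variable {W ι : Type*} [AddCommGroup W] [PartialOrder W] [IsOrderedAddMonoid W]

theorem exists_addMonoidHom_rat_eq_one {a : W} (ha : 0 < a) : ∃ g : W →+ ℚ, g a = 1 := by
  have hinj : Function.Injective (zmultiplesHom W a) := (zsmul_left_strictMono ha).injective
  obtain ⟨g, hg⟩ := (Module.Baer.of_divisible ℚ).extension_property_addMonoidHom
    (zmultiplesHom W a) hinj (Int.castAddHom ℚ)
  exact ⟨g, by simpa using DFunLike.congr_fun hg 1⟩

theorem exists_addMonoidHom_rat_apply_eq_zero {s : Finset ι} {p : ι → W} {a : W} {f : W →+ ℚ}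
    (hp : ∀ i ∈ s, 0 < p i) (ha : 0 < a) (hf : ∀ i ∈ s, 0 < f (p i)) (hfa : f a < 0)
    (ih : ∀ y : ι → W, (∀ i ∈ s, 0 < y i) → ∃ g : W →+ ℚ, ∀ i ∈ s, 0 < g (y i)) :
    ∃ h : W →+ ℚ, h a = 0 ∧ ∀ i ∈ s, 0 < h (p i) := by
  have balance : ∀ i, ∃ u v : ℕ, 0 < u ∧ 0 < v ∧ (i ∈ s → (u : ℚ) * f (p i) = v * -f a) := by
    intro i
    by_cases hi : i ∈ s
    · obtain ⟨u, v, hu, hv, huv⟩ := exists_nat_mul_eq_nat_mul (hf i hi) (neg_pos.2 hfa)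
      exact ⟨u, v, hu, hv, fun _ => huv⟩
    · exact ⟨1, 1, one_pos, one_pos, fun h => absurd h hi⟩
  choose u v hu hv huv using balance
  obtain ⟨g, hg⟩ := ih (fun i => u i • p i + v i • a) fun i hi =>
    add_pos (nsmul_pos (hp i hi) (hu i).ne') (nsmul_pos ha (hv i).ne')
  refine ⟨(-f a) • g + g a • f, ?_, fun i hi => ?_⟩
  · simp only [AddMonoidHom.add_apply, AddMonoidHom.smul_apply, smul_eq_mul]
    ring
  · have hgi : 0 < u i * g (p i) + v i * g a := by simpa using hg i hi
    refine pos_of_mul_pos_right (a := (u i : ℚ)) ?_ (Nat.cast_nonneg _)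
    calc (0 : ℚ) < -f a * (u i * g (p i) + v i * g a) := mul_pos (neg_pos.2 hfa) hgi
      _ = u i * (-f a * g (p i)) + g a * (v i * -f a) := by ring
      _ = u i * ((-f a) • g + g a • f) (p i) := by
        rw [← huv i hi]
        simp only [AddMonoidHom.add_apply, AddMonoidHom.smul_apply, smul_eq_mul]
        ring

theorem exists_addMonoidHom_rat_pos_of_apply_eq_zero {s : Finset ι} {p : ι → W} {a : W}
    {f : W →+ ℚ} (ha : 0 < a) (hf : ∀ i ∈ s, 0 < f (p i)) (hfa : f a = 0) :
    ∃ h : W →+ ℚ, 0 < h a ∧ ∀ i ∈ s, 0 < h (p i) := by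
  obtain ⟨g, hga⟩ := exists_addMonoidHom_rat_eq_one ha
  have large : ∀ᶠ N : ℕ in Filter.atTop, ∀ i ∈ s, -g (p i) < N * f (p i) :=
    (Filter.eventually_all_finset s).2 fun i hi =>
      (tendsto_natCast_atTop_atTop.atTop_mul_const (hf i hi)).eventually_gt_atTop _
  obtain ⟨N, hN⟩ := large.exists
  refine ⟨N • f + g, ?_, fun i hi => ?_⟩
  · simp [hfa, hga]
  · simpa using neg_lt_iff_pos_add.1 (hN i hi)

/-- The step of the induction corrects a functional that is negative at the new element by a
functional that is positive at the combinations where the first one vanishes. -/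
theorem exists_addMonoidHom_rat_pos (s : Finset ι) (p : ι → W) (hp : ∀ i ∈ s, 0 < p i) :
    ∃ f : W →+ ℚ, ∀ i ∈ s, 0 < f (p i) := by
  classical
  induction s using Finset.induction_on generalizing p with
  | empty => exact ⟨0, by simp⟩
  | insert k s _ ih =>
    simp only [Finset.forall_mem_insert] at hp ⊢
    obtain ⟨hk, hs⟩ := hp
    obtain ⟨f, hf⟩ := ih p hs
    rcases lt_trichotomy (f (p k)) 0 with hneg | hzero | hpos
    · obtain ⟨h, hhk, hh⟩ := exists_addMonoidHom_rat_apply_eq_zero hs hk hf hneg ih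
      exact exists_addMonoidHom_rat_pos_of_apply_eq_zero hk hh hhk
    · exact exists_addMonoidHom_rat_pos_of_apply_eq_zero hk hf hzero
    · exact ⟨f, hpos, hf⟩

end OrderedGroup

section Amalgamation

variable {W ι : Type*} [AddCommGroup W] [PartialOrder W] [IsOrderedAddMonoid W]

theorem exists_addMonoidHom_rat_pos_of_addSubgroup (R : AddSubgroup W)
    (hR : ∀ r ∈ R, 0 ≤ r → r = 0) (s : Finset ι) (p : ι → W) (hp : ∀ i ∈ s, 0 < p i) :
    ∃ f : W →+ ℚ, (∀ r ∈ R, f r = 0) ∧ ∀ i ∈ s, 0 < f (p i) := by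
  let cone : AddGroupCone (W ⧸ R) :=
    { (AddSubmonoid.nonneg W).map (QuotientAddGroup.mk' R) with
      eq_zero_of_mem_of_neg_mem' := by
        rintro _ ⟨x, hx : 0 ≤ x, rfl⟩ ⟨y, hy : 0 ≤ y, hyx⟩
        have hmem : y + x ∈ R := by
          rw [← QuotientAddGroup.eq_zero_iff, QuotientAddGroup.mk_add, add_eq_zero_iff_eq_neg]
          exact hyx
        rw [((add_eq_zero_iff_of_nonneg hy hx).1 (hR _ hmem (add_nonneg hy hx))).2, map_zero] }
  let _ : PartialOrder (W ⧸ R) := .mkOfAddGroupCone cone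
  have _ : IsOrderedAddMonoid (W ⧸ R) := .mkOfCone cone
  have mk_pos : ∀ i ∈ s, 0 < QuotientAddGroup.mk' R (p i) := fun i hi => by
    refine lt_of_le_of_ne ?_ fun h => (hp i hi).ne' (hR _ ?_ (hp i hi).le)
    · change _ - 0 ∈ cone
      rw [sub_zero]
      exact ⟨p i, (hp i hi).le, rfl⟩
    · exact (QuotientAddGroup.eq_zero_iff _).1 h.symm
  obtain ⟨f, hf⟩ := exists_addMonoidHom_rat_pos s _ mk_pos
  refine ⟨f.comp (QuotientAddGroup.mk' R), fun r hr => ?_, hf⟩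
  rw [AddMonoidHom.comp_apply, QuotientAddGroup.mk'_apply, (QuotientAddGroup.eq_zero_iff r).2 hr,
    map_zero]

variable {H : Type*} [AddCommGroup H] {G : ι → Type*} [∀ i, AddCommGroup (G i)]

/-- The subgroup of a product of groups by which the copies of a common part `H` are identified. -/
def amalgamSubgroup [Fintype ι] (j : ∀ i, H →+ G i) : AddSubgroup (∀ i, G i) :=
  (AddMonoidHom.ker (∑ i, Pi.evalAddMonoidHom (fun _ : ι => H) i)).map
    (AddMonoidHom.mk' (fun c i => j i (c i)) fun c d => funext fun i => map_add (j i) (c i) (d i))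

theorem mem_amalgamSubgroup [Fintype ι] {j : ∀ i, H →+ G i} {x : ∀ i, G i} :
    x ∈ amalgamSubgroup j ↔ ∃ c : ι → H, ∑ i, c i = 0 ∧ (fun i => j i (c i)) = x := by
  simp [amalgamSubgroup, AddMonoidHom.mem_ker]

theorem single_sub_single_mem_amalgamSubgroup [Fintype ι] [DecidableEq ι] (j : ∀ i, H →+ G i)
    (i k : ι) (c : H) : Pi.single i (j i c) - Pi.single k (j k c) ∈ amalgamSubgroup j := by
  refine mem_amalgamSubgroup.2 ⟨Pi.single i c - Pi.single k c, by simp, ?_⟩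
  ext l
  simp only [Pi.sub_apply, map_sub, Pi.apply_single (fun l => j l) (fun l => map_zero (j l))]

variable [LinearOrder H] [IsOrderedAddMonoid H] [∀ i, PartialOrder (G i)]

theorem eq_zero_of_mem_amalgamSubgroup [Fintype ι] {j : ∀ i, H →+ G i}
    (hj : ∀ i, StrictMono (j i)) {x : ∀ i, G i} (hx : x ∈ amalgamSubgroup j) (h0 : 0 ≤ x) :
    x = 0 := by
  obtain ⟨c, hc, rfl⟩ := mem_amalgamSubgroup.1 hx
  have c_nonneg : ∀ i ∈ Finset.univ, 0 ≤ c i := fun i _ =>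
    (hj i).le_iff_le.1 ((map_zero (j i)).trans_le (h0 i))
  funext i
  rw [(Finset.sum_eq_zero_iff_of_nonneg c_nonneg).1 hc i (Finset.mem_univ i), map_zero]
  rfl

theorem exists_compatible_addMonoidHom_rat_pos [Finite ι] [∀ i, IsOrderedAddMonoid (G i)]
    (j : ∀ i, H →+ G i) (hj : ∀ i, StrictMono (j i)) (s : ∀ i, Finset (G i))
    (hs : ∀ i, ∀ x ∈ s i, 0 < x) :
    ∃ f : ∀ i, G i →+ ℚ, (∀ i k c, f i (j i c) = f k (j k c)) ∧ ∀ i, ∀ x ∈ s i, 0 < f i x := by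
  classical
  have := Fintype.ofFinite ι
  obtain ⟨f, hfj, hf⟩ := exists_addMonoidHom_rat_pos_of_addSubgroup (amalgamSubgroup j)
    (fun r => eq_zero_of_mem_amalgamSubgroup hj) (Finset.univ.sigma s)
    (fun x => Pi.single x.1 x.2) fun x hx => Pi.single_pos.2 (hs x.1 x.2 (Finset.mem_sigma.1 hx).2)
  refine ⟨fun i => f.comp (AddMonoidHom.single G i), fun i k c => ?_, fun i x hx => ?_⟩
  · rw [← sub_eq_zero]
    exact (map_sub f _ _).symm.trans (hfj _ (single_sub_single_mem_amalgamSubgroup j i k c))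
  · exact hf ⟨i, x⟩ (Finset.mem_sigma.2 ⟨Finset.mem_univ i, hx⟩)

end Amalgamation

section Scaling

theorem exists_nat_mul_eq_int (s : Finset ℚ) :
    ∃ d : ℕ, 0 < d ∧ ∀ q ∈ s, ∃ n : ℤ, d * q = n := by
  refine ⟨∏ q ∈ s, q.den, Finset.prod_pos fun q _ => q.den_pos, fun q hq => ?_⟩
  obtain ⟨e, he⟩ := Finset.dvd_prod_of_mem Rat.den hq
  refine ⟨e * q.num, ?_⟩
  rw [he, Nat.cast_mul, mul_right_comm, Rat.den_mul_eq_num]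
  push_cast
  ring

variable {ι H : Type*} [Finite ι] [AddCommGroup H] [LinearOrder H] [IsOrderedAddMonoid H]
  {G : ι → Type*} [∀ i, AddCommGroup (G i)] [∀ i, PartialOrder (G i)]
  [∀ i, IsOrderedAddMonoid (G i)]

theorem exists_compatible_addMonoidHom_rat_strictMonoOn (j : ∀ i, H →+ G i)
    (hj : ∀ i, StrictMono (j i)) (T : ∀ i, Finset (G i)) :
    ∃ f : ∀ i, G i →+ ℚ, (∀ i k c, f i (j i c) = f k (j k c)) ∧
      ∀ i, StrictMonoOn (f i) (T i : Set (G i)) := by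
  classical
  obtain ⟨f, hfj, hf⟩ := exists_compatible_addMonoidHom_rat_pos j hj
    (fun i => ((T i ×ˢ T i).image fun p => p.2 - p.1).filter (0 < ·))
    fun i x hx => (Finset.mem_filter.1 hx).2
  refine ⟨f, hfj, fun i x hx y hy hxy => ?_⟩
  rw [← sub_pos, ← map_sub]
  exact hf i _ (Finset.mem_filter.2 ⟨Finset.mem_image_of_mem (fun p => p.2 - p.1)
    (Finset.mk_mem_product hx hy), sub_pos.2 hxy⟩)

theorem exists_compatible_addMonoidHom_rat_strictMonoOn_int (j : ∀ i, H →+ G i)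
    (hj : ∀ i, StrictMono (j i)) (T : ∀ i, Finset (G i)) :
    ∃ f : ∀ i, G i →+ ℚ, (∀ i k c, f i (j i c) = f k (j k c)) ∧
      ∀ i, StrictMonoOn (f i) (T i : Set (G i)) ∧ ∀ x ∈ T i, ∃ n : ℤ, f i x = n := by
  classical
  have := Fintype.ofFinite ι
  obtain ⟨f, hfj, hf⟩ := exists_compatible_addMonoidHom_rat_strictMonoOn j hj T
  obtain ⟨d, hd, hint⟩ := exists_nat_mul_eq_int
    (Finset.univ.biUnion fun i => (T i).image (f i))
  refine ⟨fun i => d • f i, fun i k c => ?_, fun i => ⟨fun x hx y hy hxy => ?_, fun x hx => ?_⟩⟩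
  · simp only [AddMonoidHom.nsmul_apply, hfj i k c]
  · exact nsmul_lt_nsmul_right hd.ne' (hf i hx hy hxy)
  · rw [AddMonoidHom.nsmul_apply, nsmul_eq_mul]
    exact hint _ (Finset.mem_biUnion.2 ⟨i, Finset.mem_univ i, Finset.mem_image_of_mem _ hx⟩)

end Scaling

/-! ### Approximation of MV-chains by finite chains -/

namespace MVAlgebra

open MonadicMV ChangGroup

/-- The map `k` from an MV-chain to a finite chain `Lₘ` preserves the operations and the order as
far as they are applied to elements of `S`. -/
structure IsChainApprox {C : Type*} [MVAlgebra C] {m : ℕ} (S : Set C) (k : C → Chain m) : Prop where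
  map_zero : k 0 = 0
  map_compl : ∀ x ∈ S, k xᶜ = (k x).neg
  map_add : ∀ x ∈ S, ∀ y ∈ S, k (x + y) = (k x).oplus (k y)
  strictMonoOn : StrictMonoOn k S

/-- The element of `Lₘ` corresponding to the integer part of `q`, which is cut off at `m`. -/
def toChain (m : ℕ) (q : ℚ) : Chain m := ⟨min ⌊q⌋₊ m, by omega⟩

theorem toChain_natCast {m n : ℕ} (h : n ≤ m) : toChain m n = ⟨n, by omega⟩ := by
  simp only [toChain, Nat.floor_natCast, min_eq_left h]

theorem isChainApprox_toChain {C : Type*} [MVAlgebra C] {S : Set C} {m : ℕ} {a : C → ℚ}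
    (h0 : a 0 = 0) (hcompl : ∀ x ∈ S, a xᶜ = m - a x)
    (hadd : ∀ x ∈ S, ∀ y ∈ S, a (x + y) = min (a x + a y) m)
    (hint : ∀ x ∈ S, ∃ n ≤ m, a x = (n : ℕ)) (hmono : StrictMonoOn a S) :
    IsChainApprox S fun x => toChain m (a x) where
  map_zero := by simp only [h0, ← Nat.cast_zero (R := ℚ), toChain_natCast m.zero_le]; rfl
  map_compl x hx := by
    obtain ⟨n, hn, hxn⟩ := hint x hx
    rw [hcompl x hx, hxn, ← Nat.cast_sub hn, toChain_natCast hn, toChain_natCast (Nat.sub_le m n)]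
    rfl
  map_add x hx y hy := by
    obtain ⟨n, hn, hxn⟩ := hint x hx
    obtain ⟨p, hp, hyp⟩ := hint y hy
    rw [hadd x hx y hy, hxn, hyp, ← Nat.cast_add, ← Nat.cast_min, toChain_natCast hn,
      toChain_natCast hp, toChain_natCast (min_le_right _ _)]
    rfl
  strictMonoOn x hx y hy hxy := by
    obtain ⟨n, hn, hxn⟩ := hint x hx
    obtain ⟨p, hp, hyp⟩ := hint y hy
    have hnp := hmono hx hy hxy
    rw [hxn, hyp, Nat.cast_lt] at hnp
    simpa only [hxn, hyp, toChain_natCast hn, toChain_natCast hp, Fin.mk_lt_mk] using hnp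

open Pointwise in
theorem isChainApprox_of_addMonoidHom {C : Type*} [MVAlgebra C] [Nontrivial C]
    [Std.Total ((· ≤ ·) : C → C → Prop)] {S : Set C} {m : ℕ} {T : Set (ChangGroup C)}
    {f : ChangGroup C →+ ℚ} (h0 : 0 ∈ T) (h1 : incl 1 ∈ T) (hS : incl '' S ⊆ T)
    (hmono : StrictMonoOn f (T + T)) (hint : ∀ x ∈ T, ∃ n : ℤ, f x = n) (hm : f (incl 1) = m) :
    IsChainApprox S fun x => toChain m (f (incl x)) := by
  have hTT : T ⊆ T + T := fun x hx => ⟨x, hx, 0, h0, add_zero x⟩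
  have mem_of_mem : ∀ {x}, x ∈ S → incl x ∈ T := fun hx => hS (Set.mem_image_of_mem _ hx)
  refine isChainApprox_toChain ?_ (fun x _ => ?_) (fun x hx y hy => ?_) (fun x hx => ?_)
    fun x hx y hy hxy => hmono (hTT (mem_of_mem hx)) (hTT (mem_of_mem hy)) (incl_strictMono hxy)
  · rw [incl_zero, map_zero]
  · rw [incl_compl, map_sub, hm]
  · rw [incl_add, hmono.monotoneOn.map_min (Set.add_mem_add (mem_of_mem hx) (mem_of_mem hy))
      (hTT h1), map_add, hm]
  · obtain ⟨n, hn⟩ := hint _ (mem_of_mem hx)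
    have hn0 := hmono.monotoneOn (hTT h0) (hTT (mem_of_mem hx)) (incl_nonneg x)
    have hnm := hmono.monotoneOn (hTT (mem_of_mem hx)) (hTT h1) (incl_le_incl_one x)
    rw [map_zero, hn, Int.cast_nonneg_iff] at hn0
    lift n to ℕ using hn0
    rw [hn, hm, Int.cast_natCast, Nat.cast_le] at hnm
    exact ⟨n, hnm, hn⟩

variable {ι : Type*} [Finite ι] [Nonempty ι] {B : Type*} [MVAlgebra B] [Nontrivial B]
  [Std.Total ((· ≤ ·) : B → B → Prop)] {C : ι → Type*} [∀ i, MVAlgebra (C i)]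
  [∀ i, Nontrivial (C i)] [∀ i, Std.Total ((· ≤ ·) : C i → C i → Prop)]

open Classical Pointwise in
theorem exists_compatible_isChainApprox (j : ∀ i, Hom B (C i))
    (hj : ∀ i, Function.Injective (j i)) (S : ∀ i, Finset (C i)) :
    ∃ m : ℕ, 0 < m ∧ ∃ k : ∀ i, C i → Chain m, (∀ i, IsChainApprox (S i : Set (C i)) (k i)) ∧
      ∀ i l b, k i (j i b) = k l (j l b) := by
  let T (i : ι) : Finset (ChangGroup (C i)) := {0, incl 1} ∪ (S i).image incl
  have zero_mem : ∀ i, 0 ∈ T i := fun i => by simp [T]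
  have one_mem : ∀ i, incl 1 ∈ T i := fun i => by simp [T]
  have subset_add : ∀ i, T i ⊆ T i + T i := fun i x hx =>
    Finset.mem_add.2 ⟨x, hx, 0, zero_mem i, add_zero x⟩
  obtain ⟨f, hfj, hf⟩ := exists_compatible_addMonoidHom_rat_strictMonoOn_int
    (fun i => ChangGroup.map (j i) (hj i)) (fun i => map_strictMono (hj i)) fun i => T i + T i
  have agree : ∀ i l b, f i (incl (j i b)) = f l (incl (j l b)) := fun i l b => by
    rw [← map_incl (hj i), ← map_incl (hj l), hfj i l]
  obtain ⟨i₀⟩ := ‹Nonempty ι›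
  have one_pos : 0 < f i₀ (incl 1) := by
    rw [← map_zero (f i₀), ← incl_zero]
    exact (hf i₀).1 (subset_add i₀ (incl_zero (C := C i₀) ▸ zero_mem i₀))
      (subset_add i₀ (one_mem i₀)) (incl_strictMono (zero_le.lt_of_ne zero_ne_one))
  obtain ⟨m, hm⟩ := (hf i₀).2 _ (subset_add i₀ (one_mem i₀))
  rw [hm, Int.cast_pos] at one_pos
  lift m to ℕ using one_pos.le
  have map_one : ∀ i, f i (incl 1) = m := fun i => by
    rw [← (j i).map_one, agree i i₀, (j i₀).map_one, hm, Int.cast_natCast]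
  refine ⟨m, Int.natCast_pos.1 one_pos, fun i x => toChain m (f i (incl x)), fun i => ?_,
    fun i l b => congrArg (toChain m) (agree i l b)⟩
  refine isChainApprox_of_addMonoidHom (T := T i) (zero_mem i) (one_mem i) ?_ ?_
    (fun x hx => (hf i).2 x (subset_add i hx)) (map_one i)
  · simp only [T, Finset.coe_union, Finset.coe_image]
    exact Set.subset_union_right
  · exact_mod_cast (hf i).1

end MVAlgebra

/-! ### Monadic MV-algebras -/

/-- A monadic MV-algebra, with quantifiers `ex` and `all`. -/
class MonadicMVAlgebra (A : Type*) extends MVAlgebra A where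
  ex : A → A
  all : A → A
  all_imp_self : ∀ x : A, (all x)ᶜ + x = 1
  all_imp_all : ∀ x y : A, all (xᶜ + all y) = (ex x)ᶜ + all y
  all_all_imp : ∀ x y : A, all ((all x)ᶜ + y) = (all x)ᶜ + all y
  all_ex_sup : ∀ x y : A, all (ex x ⊔ y) = ex x ⊔ all y
  ex_mul_self : ∀ x : A, ex (x * x) = ex x * ex x

namespace MonadicMVAlgebra

open MVAlgebra

section Quantifiers

variable {A : Type*} [MonadicMVAlgebra A] {x y : A}

theorem all_le (x : A) : all x ≤ x := le_iff.2 (all_imp_self x)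

theorem all_zero : all (0 : A) = 0 := nonpos_iff_eq_zero.1 (all_le 0)

theorem all_ex (x : A) : all (ex x) = ex x := by
  refine le_antisymm (all_le _) ?_
  rw [← sup_idem (ex x), all_ex_sup, sup_idem]
  exact le_sup_left

theorem le_ex (x : A) : x ≤ ex x := by
  have ex_imp_ex := all_imp_all x (ex x)
  rw [all_ex, compl_add_self] at ex_imp_ex
  exact le_iff.2 (one_le_iff.1 (ex_imp_ex ▸ all_le _))

theorem all_one : all (1 : A) = 1 := by
  simpa only [add_one, compl_add_self] using all_all_imp (1 : A) 1

theorem ex_all (x : A) : ex (all x) = all x := by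
  refine le_antisymm (le_iff.2 ?_) (le_ex _)
  rw [← all_imp_all, compl_add_self, all_one]

theorem all_all (x : A) : all (all x) = all x := by
  simpa only [ex_all] using all_ex (all x)

theorem all_mono (h : x ≤ y) : all x ≤ all y := by
  rw [le_iff, ← all_all_imp, le_iff.1 ((all_le x).trans h), all_one]

theorem all_compl (x : A) : all xᶜ = (ex x)ᶜ := by
  simpa only [all_zero, add_zero] using all_imp_all x 0

theorem ex_compl (x : A) : ex xᶜ = (all x)ᶜ := by
  rw [← MVAlgebra.compl_compl (ex xᶜ), ← all_compl, MVAlgebra.compl_compl]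

theorem ex_mono (h : x ≤ y) : ex x ≤ ex y := by
  simpa only [all_compl, MVAlgebra.compl_compl] using
    compl_le_compl (all_mono (compl_le_compl h))

theorem ex_of_all_eq (hx : all x = x) : ex x = x := by
  rw [← hx, ex_all]

variable (A) in
/-- The submonoid of the elements that the quantifiers fix. -/
def fixed : AddSubmonoid A where
  carrier := {x | all x = x}
  zero_mem' := all_zero
  add_mem' {x y} (hx : all x = x) (hy : all y = y) := by
    have all_compl_eq : all xᶜ = xᶜ := by rw [all_compl, ex_of_all_eq hx]
    change all (x + y) = x + y
    simpa only [all_compl_eq, hy, MVAlgebra.compl_compl] using all_all_imp xᶜ y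

theorem mem_fixed : x ∈ fixed A ↔ all x = x := Iff.rfl

theorem all_mem_fixed (x : A) : all x ∈ fixed A := all_all x

theorem ex_mem_fixed (x : A) : ex x ∈ fixed A := all_ex x

theorem compl_mem_fixed (hx : x ∈ fixed A) : xᶜ ∈ fixed A := by
  rw [mem_fixed, all_compl, ex_of_all_eq hx]

variable (A) in
/-- The MV-algebra of the fixed elements. It is not reducible to a subtype of `A`, as its order is
the one that `MVAlgebra` defines. -/
def Fixed : Type _ := fixed A

instance : AddCommMonoid (Fixed A) := inferInstanceAs (AddCommMonoid (fixed A))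

instance : MVAlgebra (Fixed A) where
  compl x := ⟨x.1ᶜ, compl_mem_fixed x.2⟩
  compl_compl x := Subtype.ext (MVAlgebra.compl_compl x.1)
  add_compl_zero x := Subtype.ext (MVAlgebra.add_compl_zero x.1)
  lukasiewicz x y := Subtype.ext (MVAlgebra.lukasiewicz x.1 y.1)

/-- The inclusion of the algebra of fixed elements. -/
def fixedIncl : Hom (Fixed A) A where
  __ := (fixed A).subtype
  map_compl' _ := rfl

theorem fixedIncl_injective : Function.Injective (fixedIncl : Hom (Fixed A) A) :=
  Subtype.val_injective

theorem all_fixedIncl (p : Fixed A) : all (fixedIncl p) = fixedIncl p := p.2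

theorem all_mul_compl_all (x : A) : all (x * (all x)ᶜ) = 0 := by
  set e := all (x * (all x)ᶜ)
  have add_le : e + all x ≤ x := by
    refine (add_le_add_left (all_le _) _).trans_eq ?_
    simpa only [MVAlgebra.compl_compl] using mul_add_compl_of_le (x := x) (y := (all x)ᶜ)
      ((MVAlgebra.compl_compl (all x)).trans_le (all_le x))
  have add_le_all : e + all x ≤ all x := by
    have sum_mem : e + all x ∈ fixed A := add_mem (all_mem_fixed _) (all_mem_fixed x)
    exact (mem_fixed.1 sum_mem).ge.trans (all_mono add_le)
  have le_compl : e ≤ (all x)ᶜ := (all_le _).trans (mul_le_right _ _)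
  rw [← add_mul_compl_of_le le_compl, le_antisymm add_le_all le_add_self]
  exact le_compl_iff.1 (MVAlgebra.compl_compl _).ge

theorem ex_imp_all (x : A) : ex (xᶜ + all x) = 1 := by
  simpa only [compl_mul, MVAlgebra.compl_compl, all_mul_compl_all, compl_zero] using
    ex_compl (x * (all x)ᶜ)

theorem ex_pow_two_pow {w : A} (hw : ex w = 1) (n : ℕ) : ex (w ^ 2 ^ n) = 1 := by
  induction n with
  | zero => rwa [pow_zero, pow_one]
  | succ n ih => rw [pow_succ, pow_mul, pow_two, ex_mul_self, ih, mul_one]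

/-- By the axiom for `∃ (x * x)`, no power of an element `w` with `∃ w = 1` bounds a fixed element
other than `1` from below. -/
theorem le_of_mul_pow_le {w : A} (hw : ex w = 1) {p z : Fixed A} {n : ℕ}
    (h : fixedIncl p * w ^ n ≤ fixedIncl z) : p ≤ z := by
  have pow_le : w ^ 2 ^ n ≤ fixedIncl (pᶜ + z) := by
    refine (pow_le_pow_right_of_le_one' (le_one w) Nat.lt_two_pow_self.le).trans ?_
    rwa [map_add, Hom.map_compl, ← mul_le_iff, mul_comm]
  have one_le := ex_mono pow_le
  rw [ex_pow_two_pow hw, ex_of_all_eq (all_fixedIncl _)] at one_le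
  exact le_iff.2 (fixedIncl_injective (one_le_iff.1 one_le))

end Quantifiers

section PrimeFilters

variable {A : Type*} [MonadicMVAlgebra A]

/-- The filter generated by a filter of fixed elements and one further element. -/
def adjoin (P : ImplicativeFilter (Fixed A)) (w : A) : ImplicativeFilter A where
  carrier := {z | ∃ p ∈ P, ∃ n : ℕ, fixedIncl p * w ^ n ≤ z}
  one_mem' := ⟨1, P.one_mem, 0, le_one _⟩
  mp' := by
    rintro y z ⟨p, hp, n, hn⟩ ⟨q, hq, k, hk⟩
    refine ⟨p * q, ImplicativeFilter.mul_mem hp hq, n + k, ?_⟩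
    rw [Hom.map_mul, pow_add, mul_mul_mul_comm]
    exact (mul_le_mul' hn hk).trans (mul_imp_le _ _)

theorem mem_adjoin {P : ImplicativeFilter (Fixed A)} {w z : A} :
    z ∈ adjoin P w ↔ ∃ p ∈ P, ∃ n : ℕ, fixedIncl p * w ^ n ≤ z := Iff.rfl

theorem self_mem_adjoin (P : ImplicativeFilter (Fixed A)) (w : A) : w ∈ adjoin P w :=
  mem_adjoin.2 ⟨1, P.one_mem, 1, by rw [pow_one]; exact mul_le_right _ _⟩

theorem fixedIncl_mem_adjoin {P : ImplicativeFilter (Fixed A)} (w : A) {p : Fixed A} (hp : p ∈ P) :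
    fixedIncl p ∈ adjoin P w :=
  mem_adjoin.2 ⟨p, hp, 0, mul_le_left _ _⟩

theorem exists_isPrime_comap_fixedIncl_eq {P : ImplicativeFilter (Fixed A)} (hP : P.IsPrime)
    {w : A} (hw : ex w = 1) :
    ∃ Q : ImplicativeFilter A, Q.IsPrime ∧ w ∈ Q ∧ Q.comap fixedIncl = P := by
  have notMem_sup : SupClosed (fixedIncl '' {z | z ∉ P}) := by
    rintro _ ⟨y, hy, rfl⟩ _ ⟨z, hz, rfl⟩
    exact ⟨y ⊔ z, fun h => (hP.mem_or_mem h).elim hy hz, fixedIncl.map_sup y z⟩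
  have disjoint : Disjoint (adjoin P w : Set A) (fixedIncl '' {z | z ∉ P}) := by
    rw [Set.disjoint_left]
    rintro _ ⟨p, hp, n, hn⟩ ⟨z, hz, rfl⟩
    exact hz (ImplicativeFilter.mem_of_le hp (le_of_mul_pow_le hw hn))
  obtain ⟨Q, hPQ, hQP, hQ⟩ := ImplicativeFilter.exists_isPrime_disjoint
    ⟨_, Set.mem_image_of_mem _ hP.zero_notMem⟩ notMem_sup disjoint
  refine ⟨Q, hQ, hPQ (self_mem_adjoin P w), SetLike.ext fun z => ⟨fun hz => ?_, fun hz => ?_⟩⟩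
  · by_contra hzP
    exact Set.disjoint_left.1 hQP hz ⟨z, hzP, rfl⟩
  · exact hPQ (fixedIncl_mem_adjoin w hz)

end PrimeFilters

section Approximation

open MonadicMV

/-- The tuple `k` of maps from a monadic MV-algebra to a finite chain `Lₘ` preserves the operations
as far as their arguments and the values of the quantifiers lie in `S`, where the quantifiers of
tuples are the maximum and the minimum. -/
structure IsPowerApprox {A ι : Type*} [MonadicMVAlgebra A] {m : ℕ} (S : Set A)
    (k : ι → A → Chain m) : Prop where
  map_zero : ∀ i, k i 0 = 0
  map_compl : ∀ i, ∀ x ∈ S, k i xᶜ = (k i x).neg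
  map_add : ∀ i, ∀ x ∈ S, ∀ y ∈ S, k i (x + y) = (k i x).oplus (k i y)
  isGreatest_ex : ∀ i, ∀ x ∈ S, ex x ∈ S → IsGreatest (Set.range fun l => k l x) (k i (ex x))
  isLeast_all : ∀ i, ∀ x ∈ S, all x ∈ S → IsLeast (Set.range fun l => k l x) (k i (all x))

variable {A ι : Type*} [MonadicMVAlgebra A]

theorem isPowerApprox_of_monotone {m : ℕ} {S : Set A} {Q : ι → ImplicativeFilter A}
    {k : ∀ i, (Q i).Quotient → Chain m}
    (hk : ∀ i, IsChainApprox ((Q i).proj '' S) (k i))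
    (hfixed : ∀ x ∈ fixed A, ∀ i l, k i ((Q i).proj x) = k l ((Q l).proj x))
    (hall : ∀ x ∈ S, ∃ i, xᶜ + all x ∈ Q i) (hex : ∀ x ∈ S, ∃ i, xᶜᶜ + all xᶜ ∈ Q i) :
    IsPowerApprox S fun i x => k i ((Q i).proj x) := by
  have mem : ∀ i, ∀ x ∈ S, (Q i).proj x ∈ (Q i).proj '' S := fun i x => Set.mem_image_of_mem _
  have mono_of_mem : ∀ i, ∀ x ∈ S, ∀ y ∈ S, xᶜ + y ∈ Q i →
      k i ((Q i).proj x) ≤ k i ((Q i).proj y) := fun i x hx y hy h =>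
    (hk i).strictMonoOn.monotoneOn (mem i x hx) (mem i y hy) (ImplicativeFilter.proj_le_proj.2 h)
  have mono : ∀ i, ∀ x ∈ S, ∀ y ∈ S, x ≤ y → k i ((Q i).proj x) ≤ k i ((Q i).proj y) :=
    fun i x hx y hy h => mono_of_mem i x hx y hy ((le_iff.1 h).symm ▸ (Q i).one_mem)
  refine ⟨fun i => (hk i).map_zero, fun i x hx => (hk i).map_compl _ (mem i x hx),
    fun i x hx y hy => (hk i).map_add _ (mem i x hx) _ (mem i y hy),
    fun i x hx hx' => ⟨?_, ?_⟩, fun i x hx hx' => ⟨?_, ?_⟩⟩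
  · obtain ⟨l, hl⟩ := hex x hx
    rw [all_compl, MVAlgebra.compl_compl, add_comm] at hl
    exact ⟨l, (mono l x hx _ hx' (le_ex x)).antisymm (mono_of_mem l _ hx' x hx hl) |>.trans
      (hfixed _ (ex_mem_fixed x) l i)⟩
  · rintro _ ⟨l, rfl⟩
    exact (mono l x hx _ hx' (le_ex x)).trans_eq (hfixed _ (ex_mem_fixed x) l i)
  · obtain ⟨l, hl⟩ := hall x hx
    exact ⟨l, (mono_of_mem l x hx _ hx' hl).antisymm (mono l _ hx' x hx (all_le x)) |>.trans
      (hfixed _ (all_mem_fixed x) l i)⟩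
  · rintro _ ⟨l, rfl⟩
    exact (hfixed _ (all_mem_fixed x) i l).trans_le (mono l _ hx' x hx (all_le x))

theorem exists_isPowerApprox_of_comap_eq [Finite ι] [Nonempty ι]
    {P : ImplicativeFilter (Fixed A)} (hP : P.IsPrime) {Q : ι → ImplicativeFilter A}
    (hQ : ∀ i, (Q i).IsPrime) (hQP : ∀ i, (Q i).comap fixedIncl = P) {S : Set A}
    (hS : S.Finite) (hall : ∀ x ∈ S, ∃ i, xᶜ + all x ∈ Q i)
    (hex : ∀ x ∈ S, ∃ i, xᶜᶜ + all xᶜ ∈ Q i) :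
    ∃ m : ℕ, 0 < m ∧ ∃ k : ι → A → Chain m, IsPowerApprox S k ∧
      ∀ i, ∀ s ∈ S, ∀ t ∈ S, sᶜ + t ∉ Q i → k i s ≠ k i t := by
  have := hP.nontrivial
  have := hP.total
  have := fun i => (hQ i).nontrivial
  have := fun i => (hQ i).total
  obtain ⟨m, hm, k, hk, hkj⟩ := exists_compatible_isChainApprox
    (fun i => ImplicativeFilter.quotientMap fixedIncl (hQP i))
    (fun i => ImplicativeFilter.quotientMap_injective (hQP i))
    fun i => (hS.image (Q i).proj).toFinset
  simp only [Set.Finite.coe_toFinset] at hk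
  refine ⟨m, hm, fun i x => k i ((Q i).proj x), isPowerApprox_of_monotone hk
    (fun x hx i l => hkj i l (P.proj ⟨x, hx⟩)) hall hex, fun i s hs t ht hst h => hst ?_⟩
  refine ImplicativeFilter.proj_le_proj.1 (by_contra fun hle => h.not_gt ?_)
  exact (hk i).strictMonoOn (Set.mem_image_of_mem _ ht) (Set.mem_image_of_mem _ hs)
    (lt_of_le_not_ge ((total_of (· ≤ ·) _ _).resolve_left hle) hle)

theorem exists_isPowerApprox {S : Set A} (hS : S.Finite) {s t : A} (hs : s ∈ S) (ht : t ∈ S)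
    (hst : s ≠ t) :
    ∃ m n : ℕ, 0 < m ∧ 0 < n ∧ ∃ k : Fin n → A → Chain m, IsPowerApprox S k ∧
      ∃ i, k i s ≠ k i t := by
  wlog hle : ¬ s ≤ t generalizing s t
  · simp only [ne_comm (a := (_ : Fin _ → A → Chain _) _ s)]
    exact this ht hs hst.symm fun hts => hst ((not_not.1 hle).antisymm hts)
  let p : Fixed A := ⟨all (sᶜ + t), all_mem_fixed _⟩
  have p_ne_one : p ≠ 1 := fun h =>
    hle (le_iff.2 (one_le_iff.1 ((congrArg fixedIncl h).ge.trans (all_le _))))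
  obtain ⟨P, hP, hstP⟩ := ImplicativeFilter.exists_isPrime_notMem p_ne_one
  obtain ⟨n, w, -, hw⟩ := ((hS.union (hS.image compl)).insert (sᶜ + t)).fin_param
  choose Q hQ hwQ hQP using fun i => exists_isPrime_comap_fixedIncl_eq hP (ex_imp_all (w i))
  have exists_imp_all_mem : ∀ x ∈ insert (sᶜ + t) (S ∪ compl '' S), ∃ i, xᶜ + all x ∈ Q i := by
    rw [← hw]
    rintro _ ⟨i, rfl⟩
    exact ⟨i, hwQ i⟩
  obtain ⟨i, hi⟩ := exists_imp_all_mem _ (.inl rfl)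
  have : Nonempty (Fin n) := ⟨i⟩
  obtain ⟨m, hm, k, hk, hne⟩ := exists_isPowerApprox_of_comap_eq hP hQ hQP hS
    (fun x hx => exists_imp_all_mem x (.inr (.inl hx)))
    (fun x hx => exists_imp_all_mem xᶜ (.inr (.inr ⟨x, hx, rfl⟩)))
  refine ⟨m, n, hm, i.pos, k, hk, i, hne i s hs t ht fun hmem => hstP ?_⟩
  rw [← hQP i]
  exact (ImplicativeFilter.mp hmem hi : all (sᶜ + t) ∈ Q i)

end Approximation

end MonadicMVAlgebra

/-! ### Separation of finite partial subalgebras -/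

section PartialHom

open FirstOrder.Language

variable {L : FirstOrder.Language} {α A B : Type*} [L.Structure A] [L.Structure B]

/-- The map `φ` preserves each operation whose arguments and value lie in `S`, so that it is a
homomorphism on the partial subalgebra `S`. -/
def IsPartialHom (L : FirstOrder.Language) {A B : Type*} [L.Structure A] [L.Structure B]
    (S : Set A) (φ : A → B) : Prop :=
  ∀ ⦃k : ℕ⦄ (f : L.Functions k) (x : Fin k → A), (∀ i, x i ∈ S) → Structure.funMap f x ∈ S →
    φ (Structure.funMap f x) = Structure.funMap f (φ ∘ x)

/-- The values of the subterms of a term. -/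
def subtermValues (v : α → A) : L.Term α → Set A
  | .var k => {v k}
  | .func f ts => insert ((Term.func f ts).realize v) (⋃ i, subtermValues v (ts i))

theorem finite_subtermValues (v : α → A) (t : L.Term α) : (subtermValues v t).Finite := by
  induction t with
  | var k => exact Set.finite_singleton _
  | func f ts ih => exact (Set.finite_iUnion ih).insert _

theorem realize_mem_subtermValues (v : α → A) (t : L.Term α) :
    t.realize v ∈ subtermValues v t := by
  cases t with
  | var k => exact Set.mem_singleton _
  | func f ts => exact Set.mem_insert _ _

theorem IsPartialHom.realize_comp {S : Set A} {φ : A → B} (hφ : IsPartialHom L S φ) {v : α → A}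
    {t : L.Term α} (ht : subtermValues v t ⊆ S) : t.realize (φ ∘ v) = φ (t.realize v) := by
  induction t with
  | var k => rfl
  | func f ts ih =>
    have args_subset : ∀ i, subtermValues v (ts i) ⊆ S := fun i =>
      (Set.subset_iUnion_of_subset i subset_rfl).trans ((Set.subset_insert _ _).trans ht)
    rw [Term.realize_func, Term.realize_func,
      hφ f _ (fun i => args_subset i (realize_mem_subtermValues v _))
        (ht (realize_mem_subtermValues v (.func f ts)))]
    exact congrArg _ (funext fun i => ih i (args_subset i))

end PartialHom

namespace QuasiIdentity

variable {L : FirstOrder.Language.{0, 0}} {A : Type*} [L.Structure A]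

/-- The values of the subterms of the terms that occur in a quasi-identity. -/
def values (q : QuasiIdentity L) (v : ℕ → A) : Set A :=
  ⋃ e ∈ {e | e ∈ q.conclusion :: q.premises}, subtermValues v e.1 ∪ subtermValues v e.2

theorem finite_values (q : QuasiIdentity L) (v : ℕ → A) : (q.values v).Finite :=
  (List.finite_toSet _).biUnion fun e _ =>
    (finite_subtermValues v e.1).union (finite_subtermValues v e.2)

theorem subtermValues_subset_values {q : QuasiIdentity L} {e : L.Term ℕ × L.Term ℕ}
    (he : e ∈ q.conclusion :: q.premises) (v : ℕ → A) :
    subtermValues v e.1 ⊆ q.values v ∧ subtermValues v e.2 ⊆ q.values v :=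
  Set.union_subset_iff.1 (Set.subset_biUnion_of_mem
    (u := fun e : L.Term ℕ × L.Term ℕ => subtermValues v e.1 ∪ subtermValues v e.2) he)

theorem holdsIn_of_separating {q : QuasiIdentity L} {A : CategoryTheory.Bundled.{u} L.Structure}
    (h : ∀ S : Set A, S.Finite → ∀ s ∈ S, ∀ t ∈ S, s ≠ t →
      ∃ B : CategoryTheory.Bundled.{u} L.Structure, q.HoldsIn B ∧
        ∃ φ : A → B, IsPartialHom L S φ ∧ φ s ≠ φ t) :
    q.HoldsIn A := by
  intro v hv
  by_contra hne
  have subset := fun e he => subtermValues_subset_values (q := q) (e := e) he v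
  have conclusion_subset := subset _ List.mem_cons_self
  obtain ⟨B, hB, φ, hφ, hst⟩ := h _ (q.finite_values v)
    _ (conclusion_subset.1 (realize_mem_subtermValues v _))
    _ (conclusion_subset.2 (realize_mem_subtermValues v _)) hne
  refine hst ?_
  rw [← hφ.realize_comp conclusion_subset.1, ← hφ.realize_comp conclusion_subset.2]
  refine hB (φ ∘ v) fun e he => ?_
  have premise_subset := subset e (List.mem_cons_of_mem _ he)
  rw [hφ.realize_comp premise_subset.1, hφ.realize_comp premise_subset.2, hv e he]

end QuasiIdentity

namespace MonadicMV

open FirstOrder.Language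

section Operations

variable {A : Type u} [language.Structure A]

theorem funMap_zero (x : Fin 0 → A) :
    Structure.funMap (L := language) Func.zero x = zero :=
  congrArg _ (Subsingleton.elim _ _)

theorem funMap_neg (x : Fin 1 → A) :
    Structure.funMap (L := language) Func.neg x = neg (x 0) :=
  congrArg _ (funext fun i => by fin_cases i; rfl)

theorem funMap_oplus (x : Fin 2 → A) :
    Structure.funMap (L := language) Func.oplus x = oplus (x 0) (x 1) :=
  congrArg _ (funext fun i => by fin_cases i <;> rfl)

theorem funMap_ex (x : Fin 1 → A) :
    Structure.funMap (L := language) Func.ex x = ex (x 0) :=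
  congrArg _ (funext fun i => by fin_cases i; rfl)

theorem funMap_all (x : Fin 1 → A) :
    Structure.funMap (L := language) Func.all x = all (x 0) :=
  congrArg _ (funext fun i => by fin_cases i; rfl)

end Operations

/-! ### The class of monadic MV-algebras is a quasivariety -/

/-- The identity `s = t`, as a quasi-identity without premises. -/
def identity (s t : language.Term ℕ) : QuasiIdentity language := ⟨[], (s, t)⟩

theorem identity_holdsIn {s t : language.Term ℕ}
    {A : CategoryTheory.Bundled.{u} language.Structure} :
    (identity s t).HoldsIn A ↔ ∀ v : ℕ → A, s.realize v = t.realize v :=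
  ⟨fun h v => h v (by simp [identity]), fun h v _ => h v⟩

/-- The term `0`. -/
def zeroTerm : language.Term ℕ := .func (L := language) Func.zero ![]

/-- The term `¬s`. -/
def negTerm (s : language.Term ℕ) : language.Term ℕ := .func (L := language) Func.neg ![s]

/-- The term `s ⊕ t`. -/
def oplusTerm (s t : language.Term ℕ) : language.Term ℕ :=
  .func (L := language) Func.oplus ![s, t]

/-- The term `∃s`. -/
def exTerm (s : language.Term ℕ) : language.Term ℕ := .func (L := language) Func.ex ![s]

/-- The term `∀s`. -/
def allTerm (s : language.Term ℕ) : language.Term ℕ := .func (L := language) Func.all ![s]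

/-- The term `s → t`. -/
def impTerm (s t : language.Term ℕ) : language.Term ℕ := oplusTerm (negTerm s) t

/-- The term `s * t`. -/
def mulTerm (s t : language.Term ℕ) : language.Term ℕ :=
  negTerm (oplusTerm (negTerm s) (negTerm t))

/-- The term `s ∨ t`. -/
def supTerm (s t : language.Term ℕ) : language.Term ℕ :=
  oplusTerm (negTerm (oplusTerm (negTerm s) t)) t

section Realize

variable {A : Type u} [language.Structure A] (v : ℕ → A) (s t : language.Term ℕ)

theorem realize_zeroTerm : zeroTerm.realize v = zero := funMap_zero _

theorem realize_negTerm : (negTerm s).realize v = neg (s.realize v) := funMap_neg _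

theorem realize_oplusTerm :
    (oplusTerm s t).realize v = oplus (s.realize v) (t.realize v) :=
  funMap_oplus _

theorem realize_exTerm : (exTerm s).realize v = ex (s.realize v) := funMap_ex _

theorem realize_allTerm : (allTerm s).realize v = all (s.realize v) := funMap_all _

theorem realize_impTerm : (impTerm s t).realize v = imp (s.realize v) (t.realize v) := by
  rw [impTerm, realize_oplusTerm, realize_negTerm, imp]

theorem realize_mulTerm : (mulTerm s t).realize v = mul (s.realize v) (t.realize v) := by
  rw [mulTerm, realize_negTerm, realize_oplusTerm, realize_negTerm, realize_negTerm, mul]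

theorem realize_supTerm : (supTerm s t).realize v = sup (s.realize v) (t.realize v) := by
  rw [supTerm, realize_oplusTerm, realize_negTerm, realize_oplusTerm, realize_negTerm, sup]

end Realize

/-- The defining identities of monadic MV-algebras, in the order of the fields of `IsMonadicMV`. -/
def axiomList : List (QuasiIdentity language) :=
  let x : language.Term ℕ := .var 0
  let y : language.Term ℕ := .var 1
  let z : language.Term ℕ := .var 2
  [identity (oplusTerm x (oplusTerm y z)) (oplusTerm (oplusTerm x y) z),
    identity (oplusTerm x y) (oplusTerm y x),
    identity (oplusTerm x zeroTerm) x,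
    identity (negTerm (negTerm x)) x,
    identity (oplusTerm x (negTerm zeroTerm)) (negTerm zeroTerm),
    identity (supTerm x y) (supTerm y x),
    identity (impTerm (allTerm x) x) (negTerm zeroTerm),
    identity (allTerm (impTerm x (allTerm y))) (impTerm (exTerm x) (allTerm y)),
    identity (allTerm (impTerm (allTerm x) y)) (impTerm (allTerm x) (allTerm y)),
    identity (allTerm (supTerm (exTerm x) y)) (supTerm (exTerm x) (allTerm y)),
    identity (exTerm (mulTerm x x)) (mulTerm (exTerm x) (exTerm x))]

theorem isQuasivariety_MMV : IsQuasivariety MMV.{u} := by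
  refine ⟨{q | q ∈ axiomList}, fun A => ?_⟩
  simp only [axiomList, Set.mem_ofPred_eq, List.forall_mem_cons, identity_holdsIn, MMV,
    realize_zeroTerm, realize_negTerm, realize_oplusTerm, realize_exTerm, realize_allTerm,
    realize_impTerm, realize_mulTerm, realize_supTerm, Term.realize_var]
  constructor
  · intro h
    exact ⟨fun v => h.oplus_assoc _ _ _, fun v => h.oplus_comm _ _, fun v => h.oplus_zero _,
      fun v => h.neg_neg _, fun v => h.oplus_neg_zero _, fun v => h.lukasiewicz _ _,
      fun v => h.m1 _, fun v => h.m2 _ _, fun v => h.m3 _ _, fun v => h.m4 _ _, fun v => h.m5 _,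
      List.forall_mem_nil _⟩
  · rintro ⟨assoc, comm, zero, neg_neg, neg_zero, lukasiewicz, m1, m2, m3, m4, m5, -⟩
    let v : A → A → A → ℕ → A := fun x y z k => if k = 0 then x else if k = 1 then y else z
    exact
      { oplus_assoc := fun x y z => assoc (v x y z)
        oplus_comm := fun x y => comm (v x y y)
        oplus_zero := fun x => zero (v x x x)
        neg_neg := fun x => neg_neg (v x x x)
        oplus_neg_zero := fun x => neg_zero (v x x x)
        lukasiewicz := fun x y => lukasiewicz (v x y y)
        m1 := fun x => m1 (v x x x)
        m2 := fun x y => m2 (v x y y)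
        m3 := fun x y => m3 (v x y y)
        m4 := fun x y => m4 (v x y y)
        m5 := fun x => m5 (v x x x) }

/-! ### The algebras `⟨Lₘⁿ, ∃_∨, ∀_∧⟩` -/

namespace Chain

variable {m : ℕ} (a b c : Chain m)

theorem oplus_assoc : a.oplus (b.oplus c) = (a.oplus b).oplus c := by
  ext; simp only [oplus]; omega

theorem oplus_comm : a.oplus b = b.oplus a := by
  ext; simp only [oplus]; omega

theorem oplus_zero : a.oplus 0 = a := by
  ext; simp only [oplus, Fin.val_zero]; omega

theorem neg_neg : a.neg.neg = a := by
  ext; simp only [neg]; omega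

theorem oplus_neg_zero : a.oplus (neg 0) = neg 0 := by
  ext; simp only [oplus, neg, Fin.val_zero]; omega

theorem lukasiewicz : (a.neg.oplus b).neg.oplus b = (b.neg.oplus a).neg.oplus a := by
  ext; simp only [oplus, neg]; omega

variable {a b} in
theorem neg_oplus_eq_neg_zero (h : a ≤ b) : a.neg.oplus b = neg 0 := by
  rw [Fin.le_def] at h
  ext; simp only [oplus, neg, Fin.val_zero]; omega

theorem neg_antitone : Antitone (neg : Chain m → Chain m) := fun a b h => by
  rw [Fin.le_def] at h ⊢
  exact Nat.sub_le_sub_left h m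

variable {a b c} {d : Chain m} in
theorem oplus_le_oplus (hab : a ≤ b) (hcd : c ≤ d) : a.oplus c ≤ b.oplus d := by
  rw [Fin.le_def] at hab hcd ⊢
  exact min_le_min_right m (add_le_add hab hcd)

theorem sup_monotone : Monotone fun b : Chain m => (a.neg.oplus b).neg.oplus b := by
  rw [funext (lukasiewicz a)]
  exact fun b c h =>
    oplus_le_oplus (neg_antitone (oplus_le_oplus (neg_antitone h) le_rfl)) le_rfl

end Chain

section Power

variable {m n : ℕ}

theorem power_ext {x y : power.{u} m n} (h : ∀ i, x.down i = y.down i) : x = y :=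
  ULift.ext _ _ (funext h)

theorem isGreatest_ex (x : power.{u} m n) (i : Fin n) :
    IsGreatest (Set.range x.down) ((ex x).down i) := by
  have : Nonempty (Fin n) := ⟨i⟩
  obtain ⟨k, -, hk⟩ := Finset.univ.exists_mem_eq_sup Finset.univ_nonempty x.down
  exact ⟨⟨k, hk.symm⟩, Set.forall_mem_range.2 fun l => Finset.le_sup (Finset.mem_univ l)⟩

theorem isLeast_all (x : power.{u} m n) (i : Fin n) :
    IsLeast (Set.range x.down) ((all x).down i) := by
  have : Nonempty (Fin n) := ⟨i⟩
  obtain ⟨k, -, hk⟩ := Finset.univ.exists_mem_eq_inf Finset.univ_nonempty x.down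
  exact ⟨⟨k, hk.symm⟩, Set.forall_mem_range.2 fun l => Finset.inf_le (Finset.mem_univ l)⟩

variable {x y : power.{u} m n} {g : Chain m → Chain m}

theorem ex_down_of_monotone (hg : Monotone g) (h : ∀ l, y.down l = g (x.down l)) (i : Fin n) :
    (ex y).down i = g ((ex x).down i) := by
  refine (isGreatest_ex y i).unique ?_
  rw [show y.down = g ∘ x.down from funext h, Set.range_comp]
  exact hg.map_isGreatest (isGreatest_ex x i)

theorem all_down_of_monotone (hg : Monotone g) (h : ∀ l, y.down l = g (x.down l)) (i : Fin n) :
    (all y).down i = g ((all x).down i) := by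
  refine (isLeast_all y i).unique ?_
  rw [show y.down = g ∘ x.down from funext h, Set.range_comp]
  exact hg.map_isLeast (isLeast_all x i)

theorem all_down_of_antitone (hg : Antitone g) (h : ∀ l, y.down l = g (x.down l)) (i : Fin n) :
    (all y).down i = g ((ex x).down i) := by
  refine (isLeast_all y i).unique ?_
  rw [show y.down = g ∘ x.down from funext h, Set.range_comp]
  exact hg.map_isGreatest (isGreatest_ex x i)

theorem isMV_power (m n : ℕ) : IsMV (power.{u} m n) where
  oplus_assoc _ _ _ := power_ext fun _ => Chain.oplus_assoc _ _ _
  oplus_comm _ _ := power_ext fun _ => Chain.oplus_comm _ _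
  oplus_zero _ := power_ext fun _ => Chain.oplus_zero _
  neg_neg _ := power_ext fun _ => Chain.neg_neg _
  oplus_neg_zero _ := power_ext fun _ => Chain.oplus_neg_zero _
  lukasiewicz _ _ := power_ext fun _ => Chain.lukasiewicz _ _

/-- Each of the last four identities says that `∃_∨` and `∀_∧` commute with a monotone or antitone
map `Lₘ → Lₘ`, the quantified subterm in it being a constant tuple. -/
theorem power_mem_MMV (m n : ℕ) : power.{u} m n ∈ MMV where
  toIsMV := isMV_power m n
  m1 x := power_ext fun i => Chain.neg_oplus_eq_neg_zero ((isLeast_all x i).2 ⟨i, rfl⟩)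
  m2 _ y := power_ext fun i =>
    all_down_of_antitone (g := fun a => a.neg.oplus ((all y).down i))
      (fun _ _ h => Chain.oplus_le_oplus (Chain.neg_antitone h) le_rfl) (fun _ => rfl) i
  m3 x _ := power_ext fun i =>
    all_down_of_monotone (g := fun b => ((all x).down i).neg.oplus b)
      (fun _ _ h => Chain.oplus_le_oplus le_rfl h) (fun _ => rfl) i
  m4 x _ := power_ext fun i =>
    all_down_of_monotone (g := fun b => (((ex x).down i).neg.oplus b).neg.oplus b)
      (Chain.sup_monotone _) (fun _ => rfl) i
  m5 _ := power_ext fun i =>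
    ex_down_of_monotone (g := fun a => (a.neg.oplus a.neg).neg)
      (fun _ _ h => Chain.neg_antitone
        (Chain.oplus_le_oplus (Chain.neg_antitone h) (Chain.neg_antitone h))) (fun _ => rfl) i

end Power

/-! ### Finite partial subalgebras of monadic MV-algebras -/

variable {A : Type u} [language.Structure A]

/-- The abstract monadic MV-algebra given by a model of the identities. -/
abbrev IsMonadicMV.toMonadicMVAlgebra (h : IsMonadicMV A) : MonadicMVAlgebra A where
  zero := zero
  add := oplus
  compl := neg
  nsmul := @nsmulRec A ⟨zero⟩ ⟨oplus⟩
  add_assoc x y z := (h.oplus_assoc x y z).symm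
  add_comm := h.oplus_comm
  add_zero := h.oplus_zero
  zero_add x := (h.oplus_comm _ _).trans (h.oplus_zero x)
  compl_compl := h.neg_neg
  add_compl_zero := h.oplus_neg_zero
  lukasiewicz := h.lukasiewicz
  ex := ex
  all := all
  all_imp_self := h.m1
  all_imp_all := h.m2
  all_all_imp := h.m3
  all_ex_sup := h.m4
  ex_mul_self := h.m5

theorem isPartialHom_of_isPowerApprox (h : IsMonadicMV A) {m n : ℕ} {S : Set A}
    {k : Fin n → A → Chain m}
    (hk : letI := h.toMonadicMVAlgebra; MonadicMVAlgebra.IsPowerApprox S k) :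
    IsPartialHom language (B := power.{u} m n) S fun x => ⟨fun i => k i x⟩ := by
  let := h.toMonadicMVAlgebra
  intro _ f x hx hfx
  refine power_ext fun i => ?_
  cases f with
  | zero =>
    rw [funMap_zero, funMap_zero]
    exact hk.map_zero i
  | neg =>
    rw [funMap_neg, funMap_neg]
    exact hk.map_compl i _ (hx 0)
  | oplus =>
    rw [funMap_oplus, funMap_oplus]
    exact hk.map_add i _ (hx 0) _ (hx 1)
  | ex =>
    rw [funMap_ex] at hfx ⊢
    rw [funMap_ex]
    exact (hk.isGreatest_ex i _ (hx 0) hfx).unique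
      (isGreatest_ex (⟨fun l => k l (x 0)⟩ : power.{u} m n) i)
  | all =>
    rw [funMap_all] at hfx ⊢
    rw [funMap_all]
    exact (hk.isLeast_all i _ (hx 0) hfx).unique
      (isLeast_all (⟨fun l => k l (x 0)⟩ : power.{u} m n) i)

theorem IsMonadicMV.exists_isPartialHom_power (h : IsMonadicMV A) {S : Set A} (hS : S.Finite)
    {s t : A} (hs : s ∈ S) (ht : t ∈ S) (hst : s ≠ t) :
    ∃ m n : ℕ, 1 ≤ m ∧ 1 ≤ n ∧ ∃ φ : A → power.{u} m n,
      IsPartialHom language S φ ∧ φ s ≠ φ t := by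
  let := h.toMonadicMVAlgebra
  obtain ⟨m, n, hm, hn, k, hk, i, hi⟩ := MonadicMVAlgebra.exists_isPowerApprox hS hs ht hst
  refine ⟨m, n, hm, hn, _, isPartialHom_of_isPowerApprox h hk, fun heq => hi ?_⟩
  exact congrFun (congrArg ULift.down heq) i

end MonadicMV

/-- The variety of monadic MV-algebras is generated as a quasivariety by the finite algebras
`⟨Lₘⁿ, ∃_∨, ∀_∧⟩` with `m, n ≥ 1`. -/
theorem mainTheorem6 :
    IsGeneratedAsQuasivarietyBy MonadicMV.MMV.{u}
      {A | ∃ m n : ℕ, 1 ≤ m ∧ 1 ≤ n ∧ A = MonadicMV.power.{u} m n} := by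
  refine ⟨⟨MonadicMV.isQuasivariety_MMV, ?_⟩, ?_⟩
  · rintro _ ⟨m, n, -, -, rfl⟩
    exact MonadicMV.power_mem_MMV m n
  · rintro Q ⟨⟨T, hT⟩, power_mem⟩ A hA
    refine (hT A).2 fun q hq => QuasiIdentity.holdsIn_of_separating fun S hS s hs t ht hst => ?_
    obtain ⟨m, n, hm, hn, φ, hφ⟩ := hA.exists_isPartialHom_power hS hs ht hst
    exact ⟨_, (hT _).1 (power_mem ⟨m, n, hm, hn, rfl⟩) q hq, φ, hφ⟩
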